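/- **Setting.** Let $(W,S)$ be a Coxeter system with length function $\ell$. For $I\subset S$ let $W_I$ be the subgroup generated by $I$; $I$ is *finitary* if $W_I$ is finite, and then $w_I$ denotes the longest element of $W_I$. Write $Is=I\cup\{s\}$. For finitary $I,J\subset S$, an *$(I,J)$-coset* is a double coset $p\in W_I\backslash W/W_J$; $\overline p$ and $\underline p$ denote its maximal and minimal elements in the Bruhat order. It is a *core* coset if $I\cap\underline pJ\underline p^{-1}=I$ and $\underline p^{-1}I\underline p\cap J=J$, and an *identity coset* if $I=J$ and $\underline p=1$. Let $*$ also denote the product of the Coxeter (0-Hecke) monoid on $W$: $s*w=w$ if $\ell(sw)<\ell(w)$ and $s*w=sw$ otherwise, for $s \in S$. For an $(I,J)$-coset $p$ and a $(J,K)$-coset $q$ put $p*q=W_I(\overline p*\overline q)W_K$. This composition is *reduced*, written $p.q$, if $\overline p*\overline q=(\overline pw_J^{-1})\overline q=\overline p(w_J^{-1}\overline q)$ and lengths add in both of these products. An *$(I,J)$-expression* is a sequence $[I=I_0,I_1,\dots,I_d=J]$ of finitary subsets in which each $I_i$ arises from $I_{i-1}$ by adding or removing one simple reflection. Write it as $[[I=L_0\subset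 K_1\supset L_1\subset\cdots\subset K_m\supset L_m=J]]$, by grouping consecutive additions and removals. It is a *reduced expression* for the $(I,J)$-coset $p$ if $\overline p=w_{K_1}w_{L_1}^{-1}w_{K_2}\cdots w_{L_{m-1}}^{-1}w_{K_m}$ and $\ell(\overline p)=\ell(w_{K_1})-\ell(w_{L_1})+\cdots-\ell(w_{L_{m-1}})+\ell(w_{K_m})$ (for $[I]$, take $m=1$ and $K_1=I$). Write $[I+s_1-s_2+\cdots-s_{2k}]$ for the expression with $I_{2i-1}=I_{2i-2}\cup\{s_{2i-1}\}$, $s_{2i-1}\notin I_{2i-2}$, and $I_{2i}=I_{2i-1}\setminus\{s_{2i}\}$, $s_{2i}\in I_{2i-1}$. An $(I,J)$-coset is *atomic* if it is core and has a reduced expression of the form $[I+s-t]$. **Theorem.** Let $r$ be a core $(I,J)$-coset. 1. There are $k\ge 0$ and $s_1,\dots,s_{2k}\in S$ such that $[I+s_1-s_2+\cdots+s_{2k-1}-s_{2k}]=[I=I_0,I_1,\dots,I_{2k}=J]$ is a reduced expression for $r$, $s_{2i}=w_{I_{2i-1}}s_{2i-1}w_{I_{2i-1}}$ for $1\le i\le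 k$, and $r=p_1.p_2.\cdots.p_k$ is a reduced composition of atomic cosets $p_i$, where $p_i$ has the reduced expression $[I_{2i-2},I_{2i-1},I_{2i}]$ (if $k=0$, $r$ is an identity coset). 2. Either $r$ is an identity coset, and then $[I]$ is its unique reduced expression; or $r=p.q$, where $q$ is a core coset and $p$ is an atomic coset with unique reduced expression $[I+s-t]$ for some $s\in S\setminus I$ with $Is$ finitary and $t=w_{Is}sw_{Is}$. 3. The following algorithm is correct. Given $r$, if the left descent set $D$ of $\overline r$ equals $I$, halt. Otherwise choose any $s\in D\setminus I$, put $t=w_{Is}sw_{Is}$ and $I'=Is\setminus\{t\}$, record $(s,t)$, and repeat with the $(I',J)$-coset $q$ containing $w_{I'}w_{Is}\overline r$ in place of $r$. More precisely: $D=I$ if and only if $r$ is an identity coset; if $D\neq I$, then $D\setminus I\ne\emptyset$, and for every $s\in D\setminus I$ the set $Is$ is finitary, $t\in S$, the $(I,I')$-coset $p$ containing $w_{Is}$ is atomic with reduced expression $[I+s-t]$, $q$ is core, $r=p.q$, and $\ell(\overline q)<\ell(\overline r)$. Hence the algorithm always halts, and the output $(s_1,s_2),(s_3,s_4),\dots,(s_{2k-1},s_{2k})$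 of every run gives an expression for $r$ as in part 1. -/

import Mathlib

namespace CoxeterSystem

variable {B W : Type*} [Group W] {M : CoxeterMatrix B} (cs : CoxeterSystem M W)

/-- The standard parabolic subgroup `W_I`. -/
def parabolic (I : Set B) : Subgroup W := Subgroup.closure (cs.simple '' I)

/-- `I` is finitary if `W_I` is finite. -/
def IsFinitary (I : Set B) : Prop := (cs.parabolic I : Set W).Finite

/-- The longest element `w_I` of `W_I` (meaningful for finitary `I`). -/
noncomputable def longest (I : Set B) : W :=
  Classical.epsilon fun w => w ∈ cs.parabolic I ∧ ∀ v ∈ cs.parabolic I, cs.length v ≤ cs.length w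

/-- The Bruhat order on `W`: the reflexive transitive closure of `u < u t`, where `t` is a reflection
with `ℓ(u) < ℓ(u t)`. -/
def BruhatLE : W → W → Prop :=
  Relation.ReflTransGen fun u v => ∃ t, cs.IsReflection t ∧ v = u * t ∧ cs.length u < cs.length v

/-- The Bruhat-maximal element of a double coset. -/
noncomputable def maxElt (p : Set W) : W :=
  Classical.epsilon fun x => x ∈ p ∧ ∀ y ∈ p, cs.BruhatLE y x

/-- The Bruhat-minimal element of a double coset. -/
noncomputable def minElt (p : Set W) : W :=
  Classical.epsilon fun x => x ∈ p ∧ ∀ y ∈ p, cs.BruhatLE x y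

/-- The left descent set of `w`. -/
def leftDescents (w : W) : Set B := {s | cs.IsLeftDescent w s}

/-! ### Double cosets and cores -/

/-- The double coset `W_I w W_J`. -/
def coset (I J : Set B) (w : W) : Set W :=
  DoubleCoset.doubleCoset w (cs.parabolic I : Set W) (cs.parabolic J : Set W)

/-- `p` is an `(I, J)`-coset, with `I` and `J` finitary. -/
def IsCoset (I J : Set B) (p : Set W) : Prop :=
  cs.IsFinitary I ∧ cs.IsFinitary J ∧ ∃ w, p = cs.coset I J w

/-- Left redundancy `I ∩ m J m⁻¹`, where `m` is the minimal element of `p`. -/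
def leftRed (I J : Set B) (p : Set W) : Set B :=
  {s | s ∈ I ∧ ∃ t ∈ J, cs.simple s = cs.minElt p * cs.simple t * (cs.minElt p)⁻¹}

/-- Right redundancy `m⁻¹ I m ∩ J`, where `m` is the minimal element of `p`. -/
def rightRed (I J : Set B) (p : Set W) : Set B :=
  {t | t ∈ J ∧ ∃ s ∈ I, cs.simple t = (cs.minElt p)⁻¹ * cs.simple s * cs.minElt p}

/-- `p` is a core `(I, J)`-coset. -/
def IsCore (I J : Set B) (p : Set W) : Prop :=
  cs.IsCoset I J p ∧ cs.leftRed I J p = I ∧ cs.rightRed I J p = J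

/-- The `(I, J)`-coset `p` is an identity coset. -/
def IsIdentity (I J : Set B) (p : Set W) : Prop :=
  cs.IsCoset I J p ∧ I = J ∧ cs.minElt p = 1

/-! ### Composition of cosets -/

open Classical in
/-- The product `s * w` in the Coxeter monoid: `w` if `s w < w`, and `s w` otherwise. -/
noncomputable def simpleStar (s : B) (w : W) : W :=
  if cs.IsLeftDescent w s then w else cs.simple s * w

/-- The product `x * y` in the Coxeter monoid (0-Hecke monoid): if `x = s₁ ⋯ sₙ` is reduced, then
`x * y = s₁ * (s₂ * ⋯ (sₙ * y))`. -/
noncomputable def star (x y : W) : W :=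
  (Classical.choose (cs.exists_isReduced x)).foldr cs.simpleStar y

/-- `x y = x.y`, that is, lengths add. -/
def IsReducedMul (x y : W) : Prop := cs.length (x * y) = cs.length x + cs.length y

/-- The composition `p * q` of an `(I, J)`-coset `p` and a `(J, K)`-coset `q`. -/
noncomputable def comp (I K : Set B) (p q : Set W) : Set W :=
  cs.coset I K (cs.star (cs.maxElt p) (cs.maxElt q))

/-- The composition of the `(I, J)`-coset `p` and the `(J, K)`-coset `q` is reduced. -/
def IsReducedComp (J : Set B) (p q : Set W) : Prop :=
  cs.IsReducedMul (cs.maxElt p * (cs.longest J)⁻¹) (cs.maxElt q) ∧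
  cs.maxElt p * (cs.longest J)⁻¹ * cs.maxElt q = cs.star (cs.maxElt p) (cs.maxElt q) ∧
  cs.IsReducedMul (cs.maxElt p) ((cs.longest J)⁻¹ * cs.maxElt q) ∧
  cs.maxElt p * ((cs.longest J)⁻¹ * cs.maxElt q) = cs.star (cs.maxElt p) (cs.maxElt q)

/-! ### Expressions -/

/-- `K` arises from `I` by adding or by removing exactly one simple reflection. -/
def SingleStep (I K : Set B) : Prop :=
  ∃ s, (s ∉ I ∧ K = insert s I) ∨ (s ∉ K ∧ I = insert s K)

/-- `L = [I = I₀, I₁, …, I_d = J]` is a (singlestep) `(I, J)`-expression. -/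
def IsExpression (I J : Set B) (L : List (Set B)) : Prop :=
  L.head? = some I ∧ L.getLast? = some J ∧ (∀ K ∈ L, cs.IsFinitary K) ∧ L.IsChain SingleStep

open Classical in
/-- For a sequence that decomposes as `[[I₀ ⊆ K₁ ⊇ I₁ ⊆ ⋯ ⊆ K_m ⊇ I_m]]`, this is
`w_{K₁} w_{I₁}⁻¹ w_{K₂} ⋯ w_{K_m} w_{I_m}⁻¹ w_{I_m}`; in a descending chain the inner factors
cancel, and an ascending step contributes nothing. -/
noncomputable def exprElt : List (Set B) → W
  | [] => 1
  | [I] => cs.longest I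
  | I :: K :: L =>
      (if I ⊆ K then 1 else cs.longest I * (cs.longest K)⁻¹) * exprElt (K :: L)

open Classical in
/-- The corresponding alternating sum of lengths
`ℓ(K₁) - ℓ(I₁) + ℓ(K₂) - ⋯ + ℓ(K_m) - ℓ(I_m) + ℓ(I_m)`. -/
noncomputable def exprLength : List (Set B) → ℤ
  | [] => 0
  | [I] => cs.length (cs.longest I)
  | I :: K :: L =>
      (if I ⊆ K then 0 else (cs.length (cs.longest I) : ℤ) - cs.length (cs.longest K)) +
        exprLength (K :: L)

/-- `L` is a reduced expression for the `(I, J)`-coset `p`. -/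
def IsReducedExpr (I J : Set B) (L : List (Set B)) (p : Set W) : Prop :=
  cs.IsCoset I J p ∧ cs.IsExpression I J L ∧ cs.maxElt p = cs.exprElt L ∧
    (cs.length (cs.maxElt p) : ℤ) = cs.exprLength L

/-- The sequence of sets `[I + s₁ - s₂ + s₃ - s₄ ⋯]` for the list `(s₁, s₂), (s₃, s₄), …`. -/
def plusMinus : Set B → List (B × B) → List (Set B)
  | I, [] => [I]
  | I, (s, t) :: l => I :: insert s I :: plusMinus (insert s I \ {t}) l

/-- An atomic coset: a core coset with a reduced expression `[I + s - t]`. -/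
def IsAtomic (I J : Set B) (p : Set W) : Prop :=
  cs.IsCore I J p ∧ ∃ s t, cs.IsReducedExpr I J (plusMinus I [(s, t)]) p

/-- `IsAtomicComposition J I p [(s₁, s₂), …, (s_{2k-1}, s_{2k})]` says that the `(I, J)`-coset `p` is
the reduced composition `p₁.p₂.⋯.p_k` of atomic cosets, where `p_i` has the reduced expression
`[I_{2i-2}, I_{2i-1}, I_{2i}] = [I_{2i-2} + s_{2i-1} - s_{2i}]` and
`s_{2i} = w_{I_{2i-1}} s_{2i-1} w_{I_{2i-1}}`. The empty composition is the identity coset. -/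
inductive IsAtomicComposition (J : Set B) : Set B → Set W → List (B × B) → Prop
  | nil : IsAtomicComposition J J (cs.coset J J 1) []
  | cons {I : Set B} {p q : Set W} {s t : B} {l : List (B × B)}
      (ht : cs.simple t = cs.longest (insert s I) * cs.simple s * cs.longest (insert s I))
      (hp : cs.IsAtomic I (insert s I \ {t}) p)
      (hexp : cs.IsReducedExpr I (insert s I \ {t}) [I, insert s I, insert s I \ {t}] p)
      (hpq : cs.IsReducedComp (insert s I \ {t}) p q)
      (hq : IsAtomicComposition J (insert s I \ {t}) q l) :
      IsAtomicComposition J I (cs.comp I J p q) ((s, t) :: l)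

/-- `[I + s₁ - s₂ + ⋯ - s_{2k}]` is a reduced atomic expression for the `(I, J)`-coset `p`. -/
def IsReducedAtomicExpr (I J : Set B) (l : List (B × B)) (p : Set W) : Prop :=
  cs.IsReducedExpr I J (plusMinus I l) p ∧ cs.IsAtomicComposition J I p l

/-! ### The algorithm -/

/-- One step of the algorithm, from the `(I, J)`-coset `p` to the `(I', J)`-coset `q`: choose
`s ∈ leftDescents (maxElt p) \ I`, put `t = w_{Is} s w_{Is}` and `I' = Is \ t`, and let `q` be the
`(I', J)`-coset containing `w_{I'} w_{Is} (maxElt p)`. -/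
def AlgStep (J I : Set B) (p : Set W) (s t : B) (I' : Set B) (q : Set W) : Prop :=
  s ∈ cs.leftDescents (cs.maxElt p) \ I ∧
  cs.simple t = cs.longest (insert s I) * cs.simple s * cs.longest (insert s I) ∧
  I' = insert s I \ {t} ∧
  q = cs.coset I' J (cs.longest I' * cs.longest (insert s I) * cs.maxElt p)

/-- `AlgRun J I p l`: some run of the algorithm on the `(I, J)`-coset `p` halts with output `l`. It
halts at an `(I', J)`-coset `q` with `leftDescents (maxElt q) = I'`. -/
inductive AlgRun (J : Set B) : Set B → Set W → List (B × B) → Prop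
  | halt {I : Set B} {p : Set W} (h : cs.leftDescents (cs.maxElt p) = I) : AlgRun J I p []
  | step {I I' : Set B} {p q : Set W} {s t : B} {l : List (B × B)}
      (h : cs.AlgStep J I p s t I' q) (hq : AlgRun J I' q l) : AlgRun J I p ((s, t) :: l)

end CoxeterSystem

/-!
A core `(I, J)`-coset is determined by its maximal element `y`: the elements `y` that occur are
those with `I` contained in the left descent set of `y` and `I y = y J`, and then the minimal
element is `w_I y`. If `K = Is` consists of left descents of `y`, then `y = w_K.m` where
`m = w_K y` has no left descents in `K`. The opposition involution of `K` maps `K \ s = I` onto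
`I' = K \ t`, so `w_K` is the maximal element of a core `(I, I')`-coset, `w_{I'} m` is the maximal
element of a core `(I', J)`-coset, and `y = w_K w_{I'}⁻¹ (w_{I'} m)` with lengths adding. As `I'`
is a proper subset of `K`, the length drops, which makes the algorithm halt; it halts at an
identity coset, because the left descents of `y = w_I m` all lie in `I` only if `m = 1`.

Uniqueness of expressions is a matter of length: the length of an expression is at least `ℓ(w_I)`
for its first term `I`, with equality only for descending chains. For an expression of the atomic
coset that starts by descending from `I` to `Y`, the rest of the expression represents `u⁻¹ w_K`
with `u = w_I w_Y⁻¹`; moving `u⁻¹` across `w_K` into `W_{I'}` contradicts that its right descents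
contain `I'`.

The facts on Coxeter groups that this rests on come from two actions: the geometric representation
separates the simple reflections, and the action of `W` on signed reflections computes the parity
of the number of occurrences of a reflection in an inversion sequence.
-/

namespace CoreCoset

open CoxeterSystem

section Reflection

open Real Module Polynomial.Chebyshev

theorem reflection_mul_reflection_sq_eq_one {R V : Type*} [CommRing R] [AddCommGroup V]
    [Module R V] {x y : V} {f g : Dual R V} (hf : f x = 2) (hg : g y = 2) (hfy : f y = 0)
    (hgx : g x = 0) : (reflection hf * reflection hg) ^ 2 = 1 := by
  ext z
  simp only [pow_two, LinearEquiv.mul_apply, reflection_apply, map_sub, map_smul, hf, hg, hfy, hgx,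
    LinearEquiv.coe_one, id]
  module

variable {V : Type*} [AddCommGroup V] [Module ℝ V] {x y : V} {f g : Dual ℝ V}

theorem S_eval_two_mul_cos_sub {m : ℕ} (hm : 3 ≤ m) (n : ℤ) :
    (S ℝ (m - 2 - n)).eval (2 * cos (2 * π / m)) = -(S ℝ n).eval (2 * cos (2 * π / m)) := by
  have hm' : (3 : ℝ) ≤ m := by exact_mod_cast hm
  have hsin : sin (2 * π / m) ≠ 0 := by
    refine (sin_pos_of_pos_of_lt_pi (by positivity) ?_).ne'
    rw [div_lt_iff₀ (by positivity)]
    nlinarith [pi_pos]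
  have hangle : (((m - 2 - n : ℤ) : ℝ) + 1) * (2 * π / m) = 2 * π - (n + 1) * (2 * π / m) := by
    push_cast
    field_simp
    ring
  apply mul_right_cancel₀ hsin
  rw [S_two_mul_real_cos, hangle, sin_two_pi_sub, neg_mul, S_two_mul_real_cos]

theorem reflection_mul_reflection_pow_eq_one {m : ℕ} (hm : 3 ≤ m) (hf : f x = 2) (hg : g y = 2)
    (hfg : f y * g x = 4 * cos (π / m) ^ 2) : (reflection hf * reflection hg) ^ m = 1 := by
  have ht : 2 * cos (2 * π / m) = f y * g x - 2 := by
    rw [hfg, mul_div_assoc, cos_two_mul]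
    ring
  ext z
  rw [reflection_mul_reflection_pow_apply hf hg m z _ ht]
  have hsymm := S_eval_two_mul_cos_sub hm
  rcases Nat.even_or_odd' m with ⟨k, hk | hk⟩
  · have hzero := hsymm (k - 1)
    rw [show (m : ℤ) - 2 - (k - 1) = k - 1 by lia] at hzero
    rw [show ((m : ℤ) - 2) / 2 = k - 1 by lia, show ((m : ℤ) - 1) / 2 = k - 1 by lia,
      self_eq_neg.mp hzero]
    simp
  · have hneg := hsymm k
    rw [show (m : ℤ) - 2 - k = k - 1 by lia] at hneg
    rw [show ((m : ℤ) - 2) / 2 = k - 1 by lia, show ((m : ℤ) - 1) / 2 = k by lia,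
      show ((m : ℤ) - 3) / 2 = k - 1 by lia, show (m : ℤ) / 2 = k by lia, hneg]
    simp

end Reflection

variable {B W : Type*} [Group W] {M : CoxeterMatrix B} {cs : CoxeterSystem M W}

section GeometricRepresentation

open Real Module

/-- The linear form `2⟨α_i, ·⟩` of the geometric representation, whose space has the simple roots
`α_i = Finsupp.single i 1` as a basis. For `M i j = 0`, which encodes `∞`, the value at `α_j` is
`-2 * cos (π / 0) = -2`, as it should be. -/
noncomputable def geomForm (M : CoxeterMatrix B) (i : B) : Dual ℝ (B →₀ ℝ) :=
  Finsupp.linearCombination ℝ fun j => -2 * cos (π / M i j)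

theorem geomForm_single (i j : B) :
    geomForm M i (Finsupp.single j 1) = -2 * cos (π / M i j) := by
  simp [geomForm]

theorem geomForm_single_self (i : B) : geomForm M i (Finsupp.single i 1) = 2 := by
  simp [geomForm]

/-- The reflection in the simple root `α_i`, by which the `i`-th simple reflection acts in the
geometric representation. -/
noncomputable def geomReflection (M : CoxeterMatrix B) (i : B) : (B →₀ ℝ) ≃ₗ[ℝ] (B →₀ ℝ) :=
  reflection (geomForm_single_self (M := M) i)

theorem geomReflection_apply_of_ne {i k : B} (hk : k ≠ i) (z : B →₀ ℝ) :
    geomReflection M i z k = z k := by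
  simp [geomReflection, reflection_apply, hk.symm]

theorem isLiftable_geomReflection : M.IsLiftable (geomReflection M) := by
  intro i j
  rcases eq_or_ne i j with rfl | hij
  · ext1 z
    rw [M.diagonal, pow_one]
    exact involutive_reflection (geomForm_single_self (M := M) i) z
  rcases Nat.lt_or_ge (M i j) 3 with hlt | hge
  · have hM : M i j = 0 ∨ M i j = 2 := by have := M.off_diagonal i j hij; lia
    rcases hM with hM | hM
    · rw [hM, pow_zero]
    · rw [hM]
      apply reflection_mul_reflection_sq_eq_one <;>
        simp [geomForm_single, hM, M.symmetric j i]
  · apply reflection_mul_reflection_pow_eq_one hge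
    rw [geomForm_single, geomForm_single, M.symmetric j i]
    ring

/-- The geometric representation of a Coxeter group, in which distinct simple reflections act
differently. -/
noncomputable def geomRep (cs : CoxeterSystem M W) : W →* ((B →₀ ℝ) ≃ₗ[ℝ] (B →₀ ℝ)) :=
  cs.lift ⟨geomReflection M, isLiftable_geomReflection⟩

theorem geomRep_simple (cs : CoxeterSystem M W) (i : B) :
    geomRep cs (cs.simple i) = geomReflection M i :=
  cs.lift_apply_simple isLiftable_geomReflection i

theorem geomRep_apply_of_notMem {I : Set B} {a : W} (ha : a ∈ cs.parabolic I) {k : B} (hk : k ∉ I)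
    (z : B →₀ ℝ) : geomRep cs a z k = z k := by
  induction ha using Subgroup.closure_induction generalizing z with
  | mem _ hs =>
    obtain ⟨i, hi, rfl⟩ := hs
    rw [geomRep_simple]
    exact geomReflection_apply_of_ne (ne_of_mem_of_not_mem hi hk).symm z
  | one => rw [map_one]; rfl
  | mul a b _ _ iha ihb => rw [map_mul, LinearEquiv.mul_apply, iha, ihb]
  | inv a _ ih => rw [← ih, ← LinearEquiv.mul_apply, ← map_mul, mul_inv_cancel, map_one]; rfl

theorem simple_mem_parabolic_iff {I : Set B} {i : B} : cs.simple i ∈ cs.parabolic I ↔ i ∈ I := by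
  refine ⟨fun h => ?_, fun hi => Subgroup.subset_closure ⟨i, hi, rfl⟩⟩
  by_contra hi
  have hcoord := geomRep_apply_of_notMem h hi (Finsupp.single i 1)
  rw [geomRep_simple, geomReflection, reflection_apply, geomForm_single_self] at hcoord
  norm_num at hcoord

theorem simple_injective (cs : CoxeterSystem M W) : Function.Injective cs.simple := by
  intro i j hij
  rw [← Set.mem_singleton_iff, ← simple_mem_parabolic_iff (cs := cs), hij, simple_mem_parabolic_iff]
  exact Set.mem_singleton j

end GeometricRepresentation

section Inversions

/-- The permutation `(t, ε) ↦ (s_i t s_i, ε + [t = s_i])` of `W × ZMod 2`. Restricted to reflections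
`t` it is the action of `s_i` on the roots, `ε` being the sign of a root. -/
noncomputable def signedConj (cs : CoxeterSystem M W) (i : B) : Function.End (W × ZMod 2) :=
  fun x => (cs.simple i * x.1 * cs.simple i, x.2 + Set.indicator {cs.simple i} 1 x.1)

open Classical in
theorem prod_map_signedConj_reverse (ω : List B) (t : W) (ε : ZMod 2) :
    (ω.reverse.map (signedConj cs)).prod (t, ε) =
      ((cs.wordProd ω)⁻¹ * t * cs.wordProd ω, ε + ((cs.leftInvSeq ω).count t : ZMod 2)) := by
  induction ω generalizing t ε with
  | nil => simp; rfl
  | cons i ω ih =>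
    have hcount : (cs.leftInvSeq (i :: ω)).count t =
        (cs.leftInvSeq ω).count (cs.simple i * t * cs.simple i) +
          if cs.simple i = t then 1 else 0 := by
      have hconj : t = MulAut.conj (cs.simple i) (cs.simple i * t * cs.simple i) := by
        simp [mul_assoc]
      rw [leftInvSeq, List.count_cons]
      nth_rw 1 [hconj]
      rw [List.count_map_of_injective _ _ (MulAut.conj (cs.simple i)).injective]
      simp only [beq_iff_eq]
    rw [List.reverse_cons, List.map_append, List.prod_append, List.map_singleton,
      List.prod_singleton]
    change (ω.reverse.map (signedConj cs)).prod (signedConj cs i (t, ε)) = _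
    rw [signedConj, ih, hcount]
    ext
    · simp [wordProd_cons, mul_assoc]
    · simp only [Set.indicator_apply, Set.mem_singleton_iff, Pi.one_apply, eq_comm (a := t)]
      push_cast
      ring

open Classical in
theorem even_count_leftInvSeq_alternatingWord (i j : B) (t : W) :
    Even ((cs.leftInvSeq (alternatingWord i j (2 * M i j))).count t) := by
  set p := M i j
  set L := cs.leftInvSeq (alternatingWord i j (2 * p)) with hL
  have hlen : L.length = 2 * p := by simp [hL]
  have hperiod : L.take p = L.drop p := by
    apply List.ext_getElem (by simp [hlen]; lia)
    intro k hk hk'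
    have hkp : k < p := by simp only [List.length_take] at hk; lia
    simp only [List.getElem_take, List.getElem_drop, hL]
    rw [cs.getElem_leftInvSeq_alternatingWord i j p k (by lia),
      cs.getElem_leftInvSeq_alternatingWord i j p (p + k) (by lia),
      prod_alternatingWord_eq_mul_pow, prod_alternatingWord_eq_mul_pow,
      show (2 * k + 1) / 2 = k by lia, show (2 * (p + k) + 1) / 2 = p + k by lia, pow_add,
      show (cs.simple j * cs.simple i) ^ p = 1 from cs.simple_mul_simple_pow' i j, one_mul]
    simp
  rw [← List.take_append_drop p L, List.count_append, hperiod]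
  exact ⟨_, rfl⟩

theorem isLiftable_signedConj (cs : CoxeterSystem M W) : M.IsLiftable (signedConj cs) := by
  classical
  intro i j
  have hpow (n : ℕ) : (signedConj cs i * signedConj cs j) ^ n =
      ((alternatingWord j i (2 * n)).reverse.map (signedConj cs)).prod := by
    induction n with
    | zero => simp [alternatingWord]
    | succ n ih =>
      rw [pow_succ', ih, show 2 * (n + 1) = 2 * n + 1 + 1 by ring]
      simp [alternatingWord_succ, mul_assoc]
  have heven := even_count_leftInvSeq_alternatingWord (cs := cs) j i
  rw [M.symmetric j i] at heven
  have hone : cs.wordProd (alternatingWord j i (2 * M i j)) = 1 := by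
    rw [prod_alternatingWord_eq_mul_pow]
    simp
  rw [hpow]
  funext ⟨t, ε⟩
  rw [prod_map_signedConj_reverse, hone, ZMod.natCast_eq_zero_iff_even.mpr (heven t)]
  simp
  rfl

/-- The parity of the number of times `t` occurs in the left inversion sequence of any word for `w`
(see `inversionParity_wordProd`); for a reflection `t` it is `1` exactly if `t` is a left inversion
of `w` (see `inversionParity_eq_one_iff`). -/
noncomputable def inversionParity (cs : CoxeterSystem M W) (w t : W) : ZMod 2 :=
  (cs.lift ⟨signedConj cs, isLiftable_signedConj cs⟩ w⁻¹ (t, 0)).2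

open Classical in
theorem lift_signedConj_inv_wordProd (ω : List B) (t : W) (ε : ZMod 2) :
    cs.lift ⟨signedConj cs, isLiftable_signedConj cs⟩ (cs.wordProd ω)⁻¹ (t, ε) =
      ((cs.wordProd ω)⁻¹ * t * cs.wordProd ω, ε + ((cs.leftInvSeq ω).count t : ZMod 2)) := by
  have hgen : cs.lift ⟨signedConj cs, isLiftable_signedConj cs⟩ ∘ cs.simple = signedConj cs :=
    funext fun i => cs.lift_apply_simple (isLiftable_signedConj cs) i
  rw [← prod_map_signedConj_reverse, ← wordProd_reverse, wordProd, map_list_prod, List.map_map,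
    hgen]

open Classical in
theorem inversionParity_wordProd (ω : List B) (t : W) :
    inversionParity cs (cs.wordProd ω) t = (cs.leftInvSeq ω).count t := by
  rw [inversionParity, lift_signedConj_inv_wordProd, zero_add]

theorem lift_signedConj_inv (w t : W) (ε : ZMod 2) :
    cs.lift ⟨signedConj cs, isLiftable_signedConj cs⟩ w⁻¹ (t, ε) =
      (w⁻¹ * t * w, ε + inversionParity cs w t) := by
  classical
  obtain ⟨ω, -, rfl⟩ := cs.exists_isReduced w
  rw [lift_signedConj_inv_wordProd, inversionParity_wordProd]

theorem inversionParity_mul (u v t : W) : inversionParity cs (u * v) t =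
    inversionParity cs u t + inversionParity cs v (u⁻¹ * t * u) := by
  rw [inversionParity, mul_inv_rev, map_mul]
  change (cs.lift ⟨signedConj cs, isLiftable_signedConj cs⟩ v⁻¹
    (cs.lift ⟨signedConj cs, isLiftable_signedConj cs⟩ u⁻¹ (t, 0))).2 = _
  rw [lift_signedConj_inv, lift_signedConj_inv, zero_add]

theorem inversionParity_one (t : W) : inversionParity cs 1 t = 0 := by
  classical
  simpa using inversionParity_wordProd (cs := cs) [] t

theorem inversionParity_simple_self (i : B) :
    inversionParity cs (cs.simple i) (cs.simple i) = 1 := by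
  classical
  simpa using inversionParity_wordProd (cs := cs) [i] (cs.simple i)

theorem inversionParity_self {t : W} (ht : cs.IsReflection t) : inversionParity cs t t = 1 := by
  obtain ⟨u, i, rfl⟩ := ht
  have hcancel := inversionParity_mul (cs := cs) u u⁻¹ (u * cs.simple i * u⁻¹)
  rw [mul_inv_cancel, inversionParity_one] at hcancel
  rw [mul_assoc u (cs.simple i), inversionParity_mul, inversionParity_mul (cs.simple i)]
  simp only [mul_assoc, inv_mul_cancel_left, inv_mul_cancel, mul_one, inv_simple,
    simple_mul_simple_self, one_mul, inversionParity_simple_self] at hcancel ⊢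
  linear_combination -hcancel

theorem inversionParity_eq_one_iff {w t : W} (ht : cs.IsReflection t) :
    inversionParity cs w t = 1 ↔ cs.IsLeftInversion w t := by
  classical
  have himp (w : W) (hw : inversionParity cs w t = 1) : cs.IsLeftInversion w t := by
    obtain ⟨ω, hω, rfl⟩ := cs.exists_isReduced w
    apply cs.isLeftInversion_of_mem_leftInvSeq hω
    by_contra hmem
    rw [inversionParity_wordProd, List.count_eq_zero_of_not_mem hmem] at hw
    norm_num at hw
  refine ⟨himp w, fun hinv => ?_⟩
  have hsum := inversionParity_mul (cs := cs) t w t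
  rw [inversionParity_self ht, inv_mul_cancel, one_mul] at hsum
  have hnot : inversionParity cs (t * w) t ≠ 1 := fun hone =>
    ht.not_isLeftInversion_mul_right_iff.mpr hinv (himp _ hone)
  generalize inversionParity cs w t = x at hsum ⊢
  generalize inversionParity cs (t * w) t = y at hsum hnot
  revert x y
  decide

theorem isLeftInversion_mul_iff {a c t : W} (ht : cs.IsReflection t) :
    cs.IsLeftInversion (a * c) t ↔
      Xor (cs.IsLeftInversion a t) (cs.IsLeftInversion c (a⁻¹ * t * a)) := by
  have ht' : cs.IsReflection (a⁻¹ * t * a) := by simpa using ht.conj a⁻¹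
  rw [← inversionParity_eq_one_iff ht, ← inversionParity_eq_one_iff ht,
    ← inversionParity_eq_one_iff ht', inversionParity_mul]
  generalize inversionParity cs a t = x
  generalize inversionParity cs c (a⁻¹ * t * a) = y
  revert x y
  unfold Xor
  decide

theorem mem_leftInvSeq_of_isLeftInversion {ω : List B} {t : W}
    (h : cs.IsLeftInversion (cs.wordProd ω) t) : t ∈ cs.leftInvSeq ω := by
  classical
  by_contra hmem
  have hpar := (inversionParity_eq_one_iff h.1).mpr h
  rw [inversionParity_wordProd, List.count_eq_zero_of_not_mem hmem] at hpar
  norm_num at hpar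

theorem finite_setOf_isLeftInversion (w : W) : {t | cs.IsLeftInversion w t}.Finite := by
  obtain ⟨ω, -, rfl⟩ := cs.exists_isReduced w
  exact (cs.leftInvSeq ω).finite_toSet.subset fun t => mem_leftInvSeq_of_isLeftInversion

theorem setOf_isLeftInversion_injective (cs : CoxeterSystem M W) :
    Function.Injective fun w => {t | cs.IsLeftInversion w t} := by
  intro a c hac
  by_contra hne
  obtain ⟨i, hi⟩ := cs.exists_leftDescent_of_ne_one (w := a⁻¹ * c)
    (by rwa [ne_eq, inv_mul_eq_one])
  have hiff := isLeftInversion_mul_iff (a := a) (c := a⁻¹ * c) ((cs.isReflection_simple i).conj a)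
  have hi' : cs.IsLeftInversion (a⁻¹ * c) (a⁻¹ * (a * cs.simple i * a⁻¹) * a) := by
    simpa [mul_assoc, isLeftInversion_simple_iff_isLeftDescent] using hi
  rw [mul_inv_cancel_left, show cs.IsLeftInversion c (a * cs.simple i * a⁻¹) ↔
    cs.IsLeftInversion a (a * cs.simple i * a⁻¹) from (Set.ext_iff.mp hac _).symm] at hiff
  simp only [hi', Xor, not_true, and_false, true_and, false_or] at hiff
  exact iff_not_self hiff

end Inversions

section Parabolic

variable {I K : Set B} {a v x y : W} {i : B}

theorem simple_mem_parabolic (hi : i ∈ I) : cs.simple i ∈ cs.parabolic I :=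
  simple_mem_parabolic_iff.mpr hi

theorem parabolic_mono (h : I ⊆ K) : cs.parabolic I ≤ cs.parabolic K :=
  Subgroup.closure_mono (Set.image_mono h)

theorem isFinitary_of_subset (hK : cs.IsFinitary K) (h : I ⊆ K) : cs.IsFinitary I :=
  hK.subset (parabolic_mono h)

theorem mem_parabolic_of_isLeftInversion (ha : a ∈ cs.parabolic I) {t : W}
    (h : cs.IsLeftInversion a t) : t ∈ cs.parabolic I := by
  induction ha using Subgroup.closure_induction generalizing t with
  | mem _ hs =>
    obtain ⟨i, hi, rfl⟩ := hs
    rw [← wordProd_singleton] at h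
    have ht := mem_leftInvSeq_of_isLeftInversion h
    rw [leftInvSeq_singleton, List.mem_singleton] at ht
    exact ht ▸ simple_mem_parabolic hi
  | one => simp [IsLeftInversion] at h
  | mul b c hb _ ihb ihc =>
    rcases (isLeftInversion_mul_iff h.1).mp h with ⟨hbt, -⟩ | ⟨hct, -⟩
    · exact ihb hbt
    · have hmem : b * (b⁻¹ * t * b) * b⁻¹ ∈ cs.parabolic I :=
        mul_mem (mul_mem hb (ihc hct)) (inv_mem hb)
      simpa [mul_assoc] using hmem
  | inv b hb ih =>
    have hone : ¬ cs.IsLeftInversion (b⁻¹ * b) t := by simp [IsLeftInversion]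
    have hbt : cs.IsLeftInversion b (b⁻¹⁻¹ * t * b⁻¹) := by
      by_contra hnot
      exact hone ((isLeftInversion_mul_iff h.1).mpr (Or.inl ⟨h, hnot⟩))
    have hmem : b⁻¹ * (b⁻¹⁻¹ * t * b⁻¹) * b ∈ cs.parabolic I :=
      mul_mem (mul_mem (inv_mem hb) (ih hbt)) hb
    simpa [mul_assoc] using hmem

theorem mem_of_isLeftDescent (ha : a ∈ cs.parabolic I) (h : cs.IsLeftDescent a i) : i ∈ I := by
  rw [← isLeftInversion_simple_iff_isLeftDescent] at h
  exact simple_mem_parabolic_iff.mp (mem_parabolic_of_isLeftInversion ha h)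

@[elab_as_elim]
theorem parabolic_induction {P : (a : W) → a ∈ cs.parabolic I → Prop} (one : P 1 (one_mem _))
    (simple_mul : ∀ i (hi : i ∈ I) a (ha : a ∈ cs.parabolic I), ¬ cs.IsLeftDescent a i → P a ha →
      P (cs.simple i * a) (mul_mem (simple_mem_parabolic hi) ha)) (ha : a ∈ cs.parabolic I) :
    P a ha := by
  induction hn : cs.length a using Nat.strong_induction_on generalizing a with
  | _ n ih =>
    rcases eq_or_ne a 1 with rfl | hne
    · exact one
    obtain ⟨i, hi⟩ := cs.exists_leftDescent_of_ne_one hne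
    have hiI := mem_of_isLeftDescent ha hi
    have hmem := mul_mem (simple_mem_parabolic (cs := cs) hiI) ha
    have hP := simple_mul i hiI _ hmem (cs.isLeftDescent_iff_not_isLeftDescent_mul.mp hi)
      (ih _ (hn ▸ hi) hmem rfl)
    simpa only [simple_mul_simple_cancel_left] using hP

theorem mem_of_mem_of_isReduced {ω : List B} (hω : cs.IsReduced ω)
    (h : cs.wordProd ω ∈ cs.parabolic I) : ∀ i ∈ ω, i ∈ I := by
  induction ω with
  | nil => simp
  | cons j ω ih =>
    have hω' : cs.IsReduced ω := hω.drop 1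
    have hj : cs.IsLeftDescent (cs.wordProd (j :: ω)) j := by
      rw [IsLeftDescent, hω.eq, wordProd_cons, simple_mul_simple_cancel_left, hω'.eq]
      simp
    have hjI := mem_of_isLeftDescent h hj
    have htail : cs.wordProd ω ∈ cs.parabolic I := by
      rwa [wordProd_cons, Subgroup.mul_mem_cancel_left _ (simple_mem_parabolic hjI)] at h
    exact List.forall_mem_cons.mpr ⟨hjI, ih hω' htail⟩

theorem isLeftInversion_mul_of_isReducedMul (h : cs.IsReducedMul x y) {t : W}
    (hx : cs.IsLeftInversion x t) : cs.IsLeftInversion (x * y) t := by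
  refine ⟨hx.1, ?_⟩
  have htri := cs.length_mul_le (t * x) y
  rw [IsReducedMul] at h
  rw [← mul_assoc, h]
  have := hx.2
  lia

theorem isLeftDescent_mul_of_isReducedMul (h : cs.IsReducedMul x y) (hx : cs.IsLeftDescent x i) :
    cs.IsLeftDescent (x * y) i := by
  rw [← isLeftInversion_simple_iff_isLeftDescent] at hx ⊢
  exact isLeftInversion_mul_of_isReducedMul h hx

theorem isReducedMul_inv_iff : cs.IsReducedMul y⁻¹ x⁻¹ ↔ cs.IsReducedMul x y := by
  rw [IsReducedMul, IsReducedMul, ← mul_inv_rev, length_inv, length_inv, length_inv, add_comm]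

theorem isRightDescent_mul_of_isReducedMul (h : cs.IsReducedMul x y)
    (hy : cs.IsRightDescent y i) : cs.IsRightDescent (x * y) i := by
  rw [← isLeftDescent_inv_iff] at hy ⊢
  rw [mul_inv_rev]
  exact isLeftDescent_mul_of_isReducedMul (isReducedMul_inv_iff.mpr h) hy

theorem isReducedMul_of_forall_length_le
    (hv : ∀ a ∈ cs.parabolic I, cs.length v ≤ cs.length (a * v))
    (ha : a ∈ cs.parabolic I) : cs.IsReducedMul a v := by
  induction ha using parabolic_induction with
  | one => simp [IsReducedMul]
  | simple_mul i hi a ha hia ih =>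
    have hdesc : ¬ cs.IsLeftDescent (a * v) i := by
      rw [← isLeftInversion_simple_iff_isLeftDescent,
        isLeftInversion_mul_iff (cs.isReflection_simple i)]
      rintro (⟨h, -⟩ | ⟨h, -⟩)
      · exact hia ((cs.isLeftInversion_simple_iff_isLeftDescent a i).mp h)
      · exact (hv _ (mul_mem (mul_mem (inv_mem ha) (simple_mem_parabolic hi)) ha)).not_gt h.2
    rw [IsReducedMul] at ih ⊢
    rw [mul_assoc, cs.not_isLeftDescent_iff.mp hdesc, cs.not_isLeftDescent_iff.mp hia, ih]
    lia

theorem isReducedMul_of_not_isLeftDescent (hv : ∀ i ∈ I, ¬ cs.IsLeftDescent v i)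
    (ha : a ∈ cs.parabolic I) : cs.IsReducedMul a v := by
  obtain ⟨b, hb, hmin⟩ : ∃ b ∈ cs.parabolic I, ∀ c ∈ cs.parabolic I,
      cs.length (b * v) ≤ cs.length (c * v) :=
    ⟨_, Function.argminOn_mem (fun b => cs.length (b * v)) (cs.parabolic I : Set W) ⟨1, one_mem _⟩,
      fun c hc => Function.argminOn_le (fun b => cs.length (b * v)) _ hc⟩
  have hred : cs.IsReducedMul b⁻¹ (b * v) := isReducedMul_of_forall_length_le (fun c hc => by
    rw [← mul_assoc]
    exact hmin _ (mul_mem hc hb)) (inv_mem hb)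
  have hb1 : b = 1 := by
    by_contra hne
    obtain ⟨i, hi⟩ := cs.exists_leftDescent_of_ne_one (inv_ne_one.mpr hne)
    apply hv i (mem_of_isLeftDescent (inv_mem hb) hi)
    simpa using isLeftDescent_mul_of_isReducedMul hred hi
  subst hb1
  exact isReducedMul_of_forall_length_le (by simpa using hmin) ha

theorem isReducedMul_inv_mul_of_subset_leftDescents (hy : I ⊆ cs.leftDescents y)
    (ha : a ∈ cs.parabolic I) : cs.IsReducedMul a (a⁻¹ * y) := by
  induction ha using parabolic_induction with
  | one => simp [IsReducedMul]
  | simple_mul i hi a _ hia ih =>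
    have hinv : cs.IsLeftInversion (a * (a⁻¹ * y)) (cs.simple i) := by
      rw [mul_inv_cancel_left, isLeftInversion_simple_iff_isLeftDescent]
      exact hy hi
    rcases (isLeftInversion_mul_iff hinv.1).mp hinv with ⟨h, -⟩ | ⟨h, -⟩
    · exact absurd ((cs.isLeftInversion_simple_iff_isLeftDescent a i).mp h) hia
    · have hlt := h.2
      have htri := cs.length_mul_le (cs.simple i * a) ((cs.simple i * a)⁻¹ * y)
      have hlen := cs.not_isLeftDescent_iff.mp hia
      rw [IsReducedMul] at ih ⊢
      simp only [mul_inv_rev, inv_simple, mul_assoc, mul_inv_cancel_left,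
        simple_mul_simple_cancel_left] at ih hlt htri ⊢
      lia

theorem isReducedMul_mul_of_subset_rightDescents (hy : ∀ i ∈ I, cs.IsRightDescent y i)
    (ha : a ∈ cs.parabolic I) : cs.IsReducedMul (y * a) a⁻¹ := by
  have hinv : I ⊆ cs.leftDescents y⁻¹ := fun i hi => cs.isLeftDescent_inv_iff.mpr (hy i hi)
  rw [← isReducedMul_inv_iff, mul_inv_rev, inv_inv]
  exact isReducedMul_inv_mul_of_subset_leftDescents hinv ha

theorem isFinitary_of_subset_leftDescents (hy : I ⊆ cs.leftDescents y) : cs.IsFinitary I := by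
  apply Set.Finite.of_finite_image _ (setOf_isLeftInversion_injective cs).injOn
  refine (finite_setOf_isLeftInversion (cs := cs) y).finite_subsets.subset ?_
  rintro _ ⟨a, ha, rfl⟩ t ht
  simpa using
    isLeftInversion_mul_of_isReducedMul (isReducedMul_inv_mul_of_subset_leftDescents hy ha) ht

end Parabolic

section Longest

variable {I J K : Set B} {a x y : W} {i s t : B}

theorem longest_spec (hI : cs.IsFinitary I) : cs.longest I ∈ cs.parabolic I ∧
    ∀ a ∈ cs.parabolic I, cs.length a ≤ cs.length (cs.longest I) := by
  obtain ⟨w, hw⟩ := Set.exists_max_image (cs.parabolic I : Set W) cs.length hI ⟨1, one_mem _⟩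
  exact Classical.epsilon_spec (p := fun w => w ∈ cs.parabolic I ∧
    ∀ v ∈ cs.parabolic I, cs.length v ≤ cs.length w) ⟨w, hw⟩

theorem longest_mem (hI : cs.IsFinitary I) : cs.longest I ∈ cs.parabolic I := (longest_spec hI).1

theorem length_le_length_longest (hI : cs.IsFinitary I) (ha : a ∈ cs.parabolic I) :
    cs.length a ≤ cs.length (cs.longest I) := (longest_spec hI).2 a ha

theorem leftDescents_longest (hI : cs.IsFinitary I) : cs.leftDescents (cs.longest I) = I := by
  refine Set.Subset.antisymm (fun i h => mem_of_isLeftDescent (longest_mem hI) h) fun i hi => ?_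
  exact lt_of_le_of_ne
    (length_le_length_longest hI (mul_mem (simple_mem_parabolic hi) (longest_mem hI)))
    (cs.length_simple_mul_ne _ _)

theorem length_add_length_mul_longest (hI : cs.IsFinitary I) (ha : a ∈ cs.parabolic I) :
    cs.length a + cs.length (a * cs.longest I) = cs.length (cs.longest I) := by
  have h := isReducedMul_inv_mul_of_subset_leftDescents (leftDescents_longest hI).ge (inv_mem ha)
  rw [IsReducedMul, inv_inv, inv_mul_cancel_left, length_inv] at h
  exact h.symm

theorem longest_mul_self (hI : cs.IsFinitary I) : cs.longest I * cs.longest I = 1 := by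
  have h := length_add_length_mul_longest hI (longest_mem hI)
  rw [← cs.length_eq_zero_iff]
  lia

theorem longest_inv (hI : cs.IsFinitary I) : (cs.longest I)⁻¹ = cs.longest I :=
  inv_eq_of_mul_eq_one_left (longest_mul_self hI)

theorem longest_mul_cancel_left (hI : cs.IsFinitary I) (w : W) :
    cs.longest I * (cs.longest I * w) = w := by
  rw [← mul_assoc, longest_mul_self hI, one_mul]

theorem eq_longest_of_length_le (hI : cs.IsFinitary I) (ha : a ∈ cs.parabolic I)
    (h : cs.length (cs.longest I) ≤ cs.length a) : a = cs.longest I := by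
  have hlen := length_add_length_mul_longest hI ha
  have hone : a * cs.longest I = 1 := by
    rw [← cs.length_eq_zero_iff]
    lia
  rw [eq_inv_of_mul_eq_one_left hone, longest_inv hI]

theorem length_add_length_longest_mul (hI : cs.IsFinitary I) (ha : a ∈ cs.parabolic I) :
    cs.length a + cs.length (cs.longest I * a) = cs.length (cs.longest I) := by
  have h := length_add_length_mul_longest hI (inv_mem ha)
  rwa [length_inv, ← cs.length_inv (_ * _), mul_inv_rev, inv_inv, longest_inv hI] at h

theorem length_longest_lt (hK : cs.IsFinitary K) (h : I ⊂ K) :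
    cs.length (cs.longest I) < cs.length (cs.longest K) := by
  have hI := isFinitary_of_subset hK h.subset
  by_contra! hle
  apply h.ne
  rw [← leftDescents_longest hI, ← leftDescents_longest hK, eq_longest_of_length_le hK
    (parabolic_mono h.subset (longest_mem hI)) hle]

theorem isReducedMul_longest_of_subset_leftDescents (hI : cs.IsFinitary I)
    (hy : I ⊆ cs.leftDescents y) : cs.IsReducedMul (cs.longest I) (cs.longest I * y) := by
  simpa only [longest_inv hI] using
    isReducedMul_inv_mul_of_subset_leftDescents hy (longest_mem hI)

theorem not_isLeftDescent_longest_mul (hI : cs.IsFinitary I) (hy : I ⊆ cs.leftDescents y)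
    (hi : i ∈ I) : ¬ cs.IsLeftDescent (cs.longest I * y) i := by
  intro hdesc
  have hmem := mul_mem (longest_mem hI) (simple_mem_parabolic (cs := cs) hi)
  have htri := cs.length_mul_le (cs.longest I * cs.simple i) (cs.simple i * (cs.longest I * y))
  have hmax := length_le_length_longest hI hmem
  have hred := isReducedMul_longest_of_subset_leftDescents hI hy
  rw [IsReducedMul] at hred
  rw [IsLeftDescent] at hdesc
  rw [mul_assoc, simple_mul_simple_cancel_left] at htri
  lia

theorem subset_leftDescents_longest_mul (hI : cs.IsFinitary I)
    (hy : ∀ i ∈ I, ¬ cs.IsLeftDescent y i) : I ⊆ cs.leftDescents (cs.longest I * y) := fun _ hi =>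
  isLeftDescent_mul_of_isReducedMul (isReducedMul_of_not_isLeftDescent hy (longest_mem hI))
    ((leftDescents_longest hI).ge hi)

/-- The simple reflections `s` and `t` are exchanged by the opposition involution of `K`, that is,
by conjugation with the longest element of `W_K`. -/
def IsOpposite (cs : CoxeterSystem M W) (K : Set B) (s t : B) : Prop :=
  cs.simple t = cs.longest K * cs.simple s * cs.longest K

/-- Conjugation by `x` carries the simple reflections in `J` onto those in `I`, that is,
`I = x J x⁻¹`. -/
structure Intertwines (cs : CoxeterSystem M W) (I J : Set B) (x : W) : Prop where
  exists_right : ∀ i ∈ I, ∃ j ∈ J, cs.simple i * x = x * cs.simple j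
  exists_left : ∀ j ∈ J, ∃ i ∈ I, cs.simple i * x = x * cs.simple j

namespace Intertwines

theorem mul {L : Set B} (hx : Intertwines cs I J x) (hy : Intertwines cs J L y) :
    Intertwines cs I L (x * y) where
  exists_right i hi := by
    obtain ⟨j, hj, hij⟩ := hx.exists_right i hi
    obtain ⟨k, hk, hjk⟩ := hy.exists_right j hj
    exact ⟨k, hk, by rw [← mul_assoc, hij, mul_assoc, hjk, mul_assoc]⟩
  exists_left k hk := by
    obtain ⟨j, hj, hjk⟩ := hy.exists_left k hk
    obtain ⟨i, hi, hij⟩ := hx.exists_left j hj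
    exact ⟨i, hi, by rw [← mul_assoc, hij, mul_assoc, hjk, mul_assoc]⟩

theorem inv (hx : Intertwines cs I J x) : Intertwines cs J I x⁻¹ where
  exists_right j hj := by
    obtain ⟨i, hi, hij⟩ := hx.exists_left j hj
    exact ⟨i, hi, by rw [eq_inv_mul_iff_mul_eq, ← mul_assoc, ← hij, mul_inv_cancel_right]⟩
  exists_left i hi := by
    obtain ⟨j, hj, hij⟩ := hx.exists_right i hi
    exact ⟨j, hj, by rw [eq_inv_mul_iff_mul_eq, ← mul_assoc, ← hij, mul_inv_cancel_right]⟩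

theorem conj_mem (hx : Intertwines cs I J x) (ha : a ∈ cs.parabolic I) :
    x⁻¹ * a * x ∈ cs.parabolic J ∧ cs.length (x⁻¹ * a * x) ≤ cs.length a := by
  induction ha using parabolic_induction with
  | one => simp
  | simple_mul i hi a _ hia ih =>
    obtain ⟨j, hj, hij⟩ := hx.exists_right i hi
    have hconj : x⁻¹ * (cs.simple i * a) * x = cs.simple j * (x⁻¹ * a * x) := by
      have hij' : x⁻¹ * cs.simple i = cs.simple j * x⁻¹ := by
        rw [inv_mul_eq_iff_eq_mul, ← mul_assoc, ← hij, mul_inv_cancel_right]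
      rw [← mul_assoc, hij']
      simp only [mul_assoc]
    rw [hconj]
    refine ⟨mul_mem (simple_mem_parabolic hj) ih.1, (cs.length_mul_le _ _).trans ?_⟩
    rw [length_simple, cs.not_isLeftDescent_iff.mp hia]
    lia

theorem length_conj (hx : Intertwines cs I J x) (ha : a ∈ cs.parabolic I) :
    cs.length (x⁻¹ * a * x) = cs.length a := by
  refine le_antisymm (hx.conj_mem ha).2 ?_
  simpa [mul_assoc] using (hx.inv.conj_mem (hx.conj_mem ha).1).2

theorem longest_mul (hx : Intertwines cs I J x) (hI : cs.IsFinitary I) (hJ : cs.IsFinitary J) :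
    cs.longest I * x = x * cs.longest J := by
  rw [← inv_mul_eq_iff_eq_mul, ← mul_assoc]
  apply eq_longest_of_length_le hJ (hx.conj_mem (longest_mem hI)).1
  rw [hx.length_conj (longest_mem hI), ← hx.inv.length_conj (longest_mem hJ)]
  exact length_le_length_longest hI (hx.inv.conj_mem (longest_mem hJ)).1

end Intertwines

theorem exists_isOpposite (hK : cs.IsFinitary K) (hs : s ∈ K) : ∃ t ∈ K, IsOpposite cs K s t := by
  have hmem : cs.longest K * cs.simple s * cs.longest K ∈ cs.parabolic K :=
    mul_mem (mul_mem (longest_mem hK) (simple_mem_parabolic hs)) (longest_mem hK)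
  have hlen : cs.length (cs.longest K * cs.simple s * cs.longest K) = 1 := by
    have hleft := length_add_length_longest_mul hK (simple_mem_parabolic (cs := cs) hs)
    have hright := length_add_length_mul_longest hK
      (mul_mem (longest_mem hK) (simple_mem_parabolic (cs := cs) hs))
    rw [length_simple] at hleft
    lia
  obtain ⟨t, ht⟩ := cs.length_eq_one_iff.mp hlen
  exact ⟨t, simple_mem_parabolic_iff.mp (ht ▸ hmem), ht.symm⟩

theorem IsOpposite.simple_mul_longest (hK : cs.IsFinitary K) (h : IsOpposite cs K s t) :
    cs.simple s * cs.longest K = cs.longest K * cs.simple t := by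
  rw [h, ← mul_assoc, longest_mul_cancel_left hK]

theorem IsOpposite.symm (hK : cs.IsFinitary K) (h : IsOpposite cs K s t) :
    IsOpposite cs K t s := by
  rw [IsOpposite, ← h.simple_mul_longest hK, mul_assoc, longest_mul_self hK, mul_one]

theorem IsOpposite.right_unique {t' : B} (h : IsOpposite cs K s t) (h' : IsOpposite cs K s t') :
    t = t' :=
  simple_injective cs (Eq.trans h (Eq.symm h'))

theorem IsOpposite.mem (hK : cs.IsFinitary K) (hs : s ∈ K) (h : IsOpposite cs K s t) : t ∈ K := by
  obtain ⟨t', ht', hopp⟩ := exists_isOpposite hK hs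
  exact h.right_unique hopp ▸ ht'

theorem IsOpposite.intertwines_longest (hK : cs.IsFinitary K) (h : IsOpposite cs K s t) :
    Intertwines cs (K \ {s}) (K \ {t}) (cs.longest K) where
  exists_right i hi := by
    obtain ⟨j, hj, hij⟩ := exists_isOpposite hK hi.1
    refine ⟨j, ⟨hj, ?_⟩, hij.simple_mul_longest hK⟩
    rintro rfl
    exact hi.2 ((hij.symm hK).right_unique (h.symm hK))
  exists_left j hj := by
    obtain ⟨i, hi, hji⟩ := exists_isOpposite hK hj.1
    refine ⟨i, ⟨hi, ?_⟩, (hji.symm hK).simple_mul_longest hK⟩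
    rintro rfl
    exact hj.2 ((hji.symm hK).right_unique h)

theorem intertwines_longest (hK : cs.IsFinitary K) : Intertwines cs K K (cs.longest K) where
  exists_right i hi := by
    obtain ⟨j, hj, hij⟩ := exists_isOpposite hK hi
    exact ⟨j, hj, hij.simple_mul_longest hK⟩
  exists_left j hj := by
    obtain ⟨i, hi, hji⟩ := exists_isOpposite hK hj
    exact ⟨i, hi, (hji.symm hK).simple_mul_longest hK⟩

end Longest

section Star

variable {K : Set B} {a c u v x : W} {i : B}

theorem exists_simpleStar_mul_eq (hx : ¬ cs.IsLeftDescent x i) (hred : cs.IsReducedMul x u) :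
    ∃ v, cs.simpleStar i (x * u) = cs.simple i * x * v ∧ cs.IsReducedMul (cs.simple i * x) v := by
  have hlen := cs.not_isLeftDescent_iff.mp hx
  rw [simpleStar]
  split_ifs with hdesc
  · obtain ⟨-, hlt⟩ : cs.IsLeftInversion u (x⁻¹ * cs.simple i * x) := by
      rw [← isLeftInversion_simple_iff_isLeftDescent] at hx hdesc
      rcases (isLeftInversion_mul_iff (cs.isReflection_simple i)).mp hdesc with h | h
      exacts [absurd h.1 hx, h.1]
    have hfactor : x * u = cs.simple i * x * (x⁻¹ * cs.simple i * x * u) := by simp [mul_assoc]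
    refine ⟨_, hfactor, ?_⟩
    have htri := cs.length_mul_le (cs.simple i * x) (x⁻¹ * cs.simple i * x * u)
    rw [IsReducedMul] at hred ⊢
    rw [← hfactor] at htri ⊢
    lia
  · refine ⟨u, (mul_assoc _ _ _).symm, ?_⟩
    rw [IsReducedMul] at hred ⊢
    rw [mul_assoc, cs.not_isLeftDescent_iff.mp hdesc]
    lia

theorem exists_foldr_simpleStar_eq {ω : List B} (hω : cs.IsReduced ω) (y : W) :
    ∃ u, ω.foldr cs.simpleStar y = cs.wordProd ω * u ∧ cs.IsReducedMul (cs.wordProd ω) u := by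
  induction ω with
  | nil => exact ⟨y, by simp [IsReducedMul]⟩
  | cons i ω ih =>
    have hω' : cs.IsReduced ω := hω.drop 1
    have hi : ¬ cs.IsLeftDescent (cs.wordProd ω) i := by
      rw [not_isLeftDescent_iff, ← wordProd_cons, hω.eq, hω'.eq, List.length_cons]
    obtain ⟨u, hu, hred⟩ := ih hω'
    rw [List.foldr_cons, hu, wordProd_cons]
    exact exists_simpleStar_mul_eq hi hred

theorem foldr_simpleStar_mul_inv_mem {ω : List B} (hω : ∀ i ∈ ω, i ∈ K) (y : W) :
    ω.foldr cs.simpleStar y * y⁻¹ ∈ cs.parabolic K := by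
  induction ω with
  | nil => simp
  | cons i ω ih =>
    obtain ⟨hi, hω⟩ := List.forall_mem_cons.mp hω
    rw [List.foldr_cons, simpleStar]
    split_ifs
    · exact ih hω
    · rw [mul_assoc]
      exact mul_mem (simple_mem_parabolic hi) (ih hω)

theorem exists_star_eq (x y : W) : ∃ u, cs.star x y = x * u ∧ cs.IsReducedMul x u := by
  obtain ⟨hω, hx⟩ := Classical.choose_spec (cs.exists_isReduced x)
  obtain ⟨u, hu, hred⟩ := exists_foldr_simpleStar_eq hω y
  rw [← hx] at hu hred
  exact ⟨u, hu, hred⟩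

theorem star_mul_inv_mem (ha : a ∈ cs.parabolic K) (y : W) :
    cs.star a y * y⁻¹ ∈ cs.parabolic K := by
  obtain ⟨hω, hx⟩ := Classical.choose_spec (cs.exists_isReduced a)
  exact foldr_simpleStar_mul_inv_mem (mem_of_mem_of_isReduced hω (hx ▸ ha)) y

theorem star_longest_mul (hK : cs.IsFinitary K) (hv : ∀ i ∈ K, ¬ cs.IsLeftDescent v i)
    (hc : c ∈ cs.parabolic K) : cs.star (cs.longest K) (c * v) = cs.longest K * v := by
  obtain ⟨u, hu, hred⟩ := exists_star_eq (cs := cs) (cs.longest K) (c * v)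
  have hmem := star_mul_inv_mem (longest_mem hK) (c * v)
  have huv : u * v⁻¹ ∈ cs.parabolic K := by
    have h := mul_mem (mul_mem (longest_mem hK) hmem) hc
    rw [hu] at h
    simpa [mul_assoc, longest_mul_cancel_left hK] using h
  have hu' : cs.IsReducedMul (u * v⁻¹) v := isReducedMul_of_not_isLeftDescent hv huv
  have hw : cs.IsReducedMul (cs.longest K * (u * v⁻¹)) v :=
    isReducedMul_of_not_isLeftDescent hv (mul_mem (longest_mem hK) huv)
  have hlen := length_add_length_longest_mul hK huv
  have hone : u * v⁻¹ = 1 := by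
    simp only [IsReducedMul, mul_assoc, inv_mul_cancel, mul_one] at hred hu' hw hlen
    rw [← cs.length_eq_zero_iff]
    lia
  rw [hu, mul_inv_eq_one.mp hone]

end Star

section Bruhat

variable {I : Set B} {a u v y : W} {i : B}

theorem eq_or_length_lt_of_bruhatLE (h : cs.BruhatLE u v) : u = v ∨ cs.length u < cs.length v := by
  induction h with
  | refl => exact Or.inl rfl
  | tail _ h ih =>
    obtain ⟨t, -, -, hlt⟩ := h
    rcases ih with rfl | ih
    exacts [Or.inr hlt, Or.inr (ih.trans hlt)]

theorem bruhatLE_antisymm (h : cs.BruhatLE u v) (h' : cs.BruhatLE v u) : u = v := by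
  have := eq_or_length_lt_of_bruhatLE h
  have := eq_or_length_lt_of_bruhatLE h'
  grind

theorem simple_mul_bruhatLE (h : cs.IsLeftDescent u i) : cs.BruhatLE (cs.simple i * u) u :=
  Relation.ReflTransGen.single
    ⟨u⁻¹ * cs.simple i * u, ⟨u⁻¹, i, by rw [inv_inv]⟩, by simp [mul_assoc], h⟩

theorem mul_simple_bruhatLE (h : cs.IsRightDescent u i) : cs.BruhatLE (u * cs.simple i) u :=
  Relation.ReflTransGen.single ⟨cs.simple i, cs.isReflection_simple i, by simp, h⟩

theorem mul_bruhatLE_of_subset_leftDescents (hy : I ⊆ cs.leftDescents y)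
    (ha : a ∈ cs.parabolic I) : cs.BruhatLE (a * y) y := by
  induction ha using parabolic_induction with
  | one =>
    rw [one_mul]
    exact Relation.ReflTransGen.refl
  | simple_mul i hi b hb hib ih =>
    have hb_red := isReducedMul_inv_mul_of_subset_leftDescents hy (inv_mem hb)
    have hsb_red := isReducedMul_inv_mul_of_subset_leftDescents hy
      (inv_mem (mul_mem (simple_mem_parabolic (cs := cs) hi) hb))
    have hdesc : cs.IsLeftDescent (b * y) i := by
      have hlen := cs.not_isLeftDescent_iff.mp hib
      simp only [IsReducedMul, inv_inv, length_inv, inv_mul_cancel_left] at hb_red hsb_red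
      rw [IsLeftDescent, ← mul_assoc]
      lia
    rw [mul_assoc]
    exact (simple_mul_bruhatLE hdesc).trans ih

end Bruhat

section DoubleCoset

variable {I J : Set B} {a m x y : W}

theorem mem_coset :
    x ∈ cs.coset I J y ↔ ∃ a ∈ cs.parabolic I, ∃ b ∈ cs.parabolic J, x = a * y * b :=
  DoubleCoset.mem_doubleCoset

theorem self_mem_coset (cs : CoxeterSystem M W) (I J : Set B) (y : W) : y ∈ cs.coset I J y :=
  DoubleCoset.mem_doubleCoset_self _ _ y

theorem coset_eq_of_mem (h : x ∈ cs.coset I J y) : cs.coset I J x = cs.coset I J y :=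
  DoubleCoset.doubleCoset_eq_of_mem h

theorem mul_mem_coset (ha : a ∈ cs.parabolic I) (hx : x ∈ cs.coset I J y) :
    a * x ∈ cs.coset I J y := by
  rw [← coset_eq_of_mem hx]
  exact mem_coset.mpr ⟨a, ha, 1, one_mem _, by rw [mul_one]⟩

theorem mem_coset_mul (ha : a ∈ cs.parabolic J) (hx : x ∈ cs.coset I J y) :
    x * a ∈ cs.coset I J y := by
  rw [← coset_eq_of_mem hx]
  exact mem_coset.mpr ⟨1, one_mem _, a, ha, by rw [one_mul]⟩

/-- The element `m` is shortest in `W_I m W_J`, encoded as the absence of left descents in `I` and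
of right descents in `J`. -/
def IsMinRep (cs : CoxeterSystem M W) (I J : Set B) (m : W) : Prop :=
  (∀ i ∈ I, ¬ cs.IsLeftDescent m i) ∧ ∀ j ∈ J, ¬ cs.IsRightDescent m j

theorem IsMinRep.isReducedMul_left (hm : IsMinRep cs I J m) (ha : a ∈ cs.parabolic I) :
    cs.IsReducedMul a m :=
  isReducedMul_of_not_isLeftDescent hm.1 ha

theorem IsMinRep.isReducedMul_right (hm : IsMinRep cs I J m) (ha : a ∈ cs.parabolic J) :
    cs.IsReducedMul m a := by
  rw [← isReducedMul_inv_iff]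
  refine isReducedMul_of_not_isLeftDescent (fun j hj => ?_) (inv_mem ha)
  rw [isLeftDescent_inv_iff]
  exact hm.2 j hj

theorem IsMinRep.eq_of_mul_eq_mul (hm : IsMinRep cs I J m) (hy : IsMinRep cs I J y) {b : W}
    (ha : a ∈ cs.parabolic I) (hb : b ∈ cs.parabolic J) (h : a * y = m * b) : y = m := by
  induction ha using parabolic_induction generalizing b with
  | one =>
    rw [one_mul] at h
    have hmb := hm.isReducedMul_right hb
    have hyb := hy.isReducedMul_right (inv_mem hb)
    have hb1 : b = 1 := by
      rw [← cs.length_eq_zero_iff]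
      simp only [h, IsReducedMul, mul_inv_cancel_right, length_inv] at hmb hyb
      lia
    rw [h, hb1, mul_one]
  | simple_mul i hi c hc hic ih =>
    -- `i` is a left descent of `m b` but not of `m`, so it can be moved past `m` into `W_J`.
    have hinv : cs.IsLeftInversion (m * b) (cs.simple i) := by
      rw [← h]
      refine isLeftInversion_mul_of_isReducedMul
        (hy.isReducedMul_left (mul_mem (simple_mem_parabolic hi) hc)) ?_
      rwa [isLeftInversion_simple_iff_isLeftDescent,
        isLeftDescent_iff_not_isLeftDescent_mul, simple_mul_simple_cancel_left]
    have hconj : m⁻¹ * cs.simple i * m ∈ cs.parabolic J := by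
      rcases (isLeftInversion_mul_iff hinv.1).mp hinv with ⟨hmi, -⟩ | ⟨hbi, -⟩
      · exact absurd ((cs.isLeftInversion_simple_iff_isLeftDescent m i).mp hmi) (hm.1 i hi)
      · exact mem_parabolic_of_isLeftInversion hb hbi
    refine ih (mul_mem hconj hb) ?_
    rw [mul_assoc] at h
    simp [mul_assoc, ← h]

theorem IsMinRep.eq_of_mem (hm : IsMinRep cs I J m) (hy : IsMinRep cs I J y)
    (h : m ∈ cs.coset I J y) : m = y := by
  obtain ⟨a, ha, b, hb, rfl⟩ := mem_coset.mp h
  exact (hm.eq_of_mul_eq_mul hy ha (inv_mem hb) (by rw [mul_inv_cancel_right])).symm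

theorem isMinRep_of_forall_length_le (hx : x ∈ cs.coset I J y)
    (hmin : ∀ z ∈ cs.coset I J y, cs.length x ≤ cs.length z) : IsMinRep cs I J x :=
  ⟨fun _ hi h => (hmin _ (mul_mem_coset (simple_mem_parabolic hi) hx)).not_gt h,
    fun _ hj h => (hmin _ (mem_coset_mul (simple_mem_parabolic hj) hx)).not_gt h⟩

theorem IsMinRep.bruhatLE (hm : IsMinRep cs I J m) (hx : x ∈ cs.coset I J m) :
    cs.BruhatLE m x := by
  induction hn : cs.length x using Nat.strong_induction_on generalizing x with
  | _ n ih =>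
    by_cases hmin : IsMinRep cs I J x
    · rw [hmin.eq_of_mem hm hx]
      exact Relation.ReflTransGen.refl
    rw [IsMinRep, not_and_or] at hmin
    push Not at hmin
    rcases hmin with ⟨i, hi, hdesc⟩ | ⟨j, hj, hdesc⟩
    · exact (ih _ (hn ▸ hdesc) (mul_mem_coset (simple_mem_parabolic hi) hx) rfl).trans
        (simple_mul_bruhatLE hdesc)
    · exact (ih _ (hn ▸ hdesc) (mem_coset_mul (simple_mem_parabolic hj) hx) rfl).trans
        (mul_simple_bruhatLE hdesc)

theorem exists_isMinRep (cs : CoxeterSystem M W) (I J : Set B) (y : W) :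
    ∃ m ∈ cs.coset I J y, IsMinRep cs I J m := by
  obtain ⟨m, hm, hmin⟩ : ∃ m ∈ cs.coset I J y, ∀ z ∈ cs.coset I J y, cs.length m ≤ cs.length z :=
    ⟨_, Function.argminOn_mem cs.length _ ⟨y, self_mem_coset cs I J y⟩,
      fun z hz => Function.argminOn_le cs.length _ hz⟩
  exact ⟨m, hm, isMinRep_of_forall_length_le hm hmin⟩

theorem IsMinRep.minElt_eq (hm : IsMinRep cs I J m) (h : m ∈ cs.coset I J y) :
    cs.minElt (cs.coset I J y) = m := by
  rw [← coset_eq_of_mem h]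
  obtain ⟨hmem, hmin⟩ := Classical.epsilon_spec (p := fun x => x ∈ cs.coset I J m ∧
    ∀ z ∈ cs.coset I J m, cs.BruhatLE x z) ⟨m, self_mem_coset cs I J m, fun _ hx => hm.bruhatLE hx⟩
  exact bruhatLE_antisymm (hmin _ (self_mem_coset cs I J m)) (hm.bruhatLE hmem)

end DoubleCoset

section CoreMax

variable {I J K : Set B} {m x y : W} {p q : Set W} {s t : B}

/-- The element `y` is the maximal element of a core `(I, J)`-coset. Instead of the minimal element
`m`, core cosets are parametrized by `y = w_I m`, on which the algorithm operates. -/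
structure IsCoreMax (cs : CoxeterSystem M W) (I J : Set B) (y : W) : Prop where
  subset_leftDescents : I ⊆ cs.leftDescents y
  intertwines : Intertwines cs I J y

namespace IsCoreMax

theorem inv (h : IsCoreMax cs I J y) : IsCoreMax cs J I y⁻¹ where
  subset_leftDescents j hj := by
    obtain ⟨i, hi, hij⟩ := h.intertwines.exists_left j hj
    change cs.IsLeftDescent y⁻¹ j
    rw [isLeftDescent_inv_iff, IsRightDescent, ← hij]
    exact h.subset_leftDescents hi
  intertwines := h.intertwines.inv

theorem finitary_left (h : IsCoreMax cs I J y) : cs.IsFinitary I :=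
  isFinitary_of_subset_leftDescents h.subset_leftDescents

theorem finitary_right (h : IsCoreMax cs I J y) : cs.IsFinitary J := h.inv.finitary_left

theorem longest_mul (h : IsCoreMax cs I J y) : cs.longest I * y = y * cs.longest J :=
  h.intertwines.longest_mul h.finitary_left h.finitary_right

theorem mem_coset_iff (h : IsCoreMax cs I J y) :
    x ∈ cs.coset I J y ↔ ∃ a ∈ cs.parabolic I, x = a * y := by
  refine ⟨fun hx => ?_, fun ⟨a, ha, hx⟩ => hx ▸ mul_mem_coset ha (self_mem_coset cs I J y)⟩
  obtain ⟨a, ha, b, hb, rfl⟩ := mem_coset.mp hx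
  exact ⟨a * (y⁻¹⁻¹ * b * y⁻¹), mul_mem ha (h.intertwines.inv.conj_mem hb).1, by simp [mul_assoc]⟩

theorem maxElt_coset (h : IsCoreMax cs I J y) : cs.maxElt (cs.coset I J y) = y := by
  have hmax : ∀ x ∈ cs.coset I J y, cs.BruhatLE x y := fun x hx => by
    obtain ⟨a, ha, rfl⟩ := h.mem_coset_iff.mp hx
    exact mul_bruhatLE_of_subset_leftDescents h.subset_leftDescents ha
  obtain ⟨hmem, hge⟩ := Classical.epsilon_spec (p := fun x => x ∈ cs.coset I J y ∧
    ∀ z ∈ cs.coset I J y, cs.BruhatLE z x) ⟨y, self_mem_coset cs I J y, hmax⟩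
  exact bruhatLE_antisymm (hmax _ hmem) (hge _ (self_mem_coset cs I J y))

theorem isMinRep (h : IsCoreMax cs I J y) : IsMinRep cs I J (cs.longest I * y) := by
  refine ⟨fun i hi => not_isLeftDescent_longest_mul h.finitary_left h.subset_leftDescents hi,
    fun j hj => ?_⟩
  rw [← isLeftDescent_inv_iff, h.longest_mul, mul_inv_rev, longest_inv h.finitary_right]
  exact not_isLeftDescent_longest_mul h.finitary_right h.inv.subset_leftDescents hj

theorem minElt_coset (h : IsCoreMax cs I J y) :
    cs.minElt (cs.coset I J y) = cs.longest I * y :=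
  h.isMinRep.minElt_eq (mul_mem_coset (longest_mem h.finitary_left) (self_mem_coset cs I J y))

end IsCoreMax

theorem leftRed_eq_and_rightRed_eq_iff : cs.leftRed I J p = I ∧ cs.rightRed I J p = J ↔
    Intertwines cs I J (cs.minElt p) := by
  have hleft (i j : B) : cs.simple i = cs.minElt p * cs.simple j * (cs.minElt p)⁻¹ ↔
      cs.simple i * cs.minElt p = cs.minElt p * cs.simple j := eq_mul_inv_iff_mul_eq
  have hright (i j : B) : cs.simple j = (cs.minElt p)⁻¹ * cs.simple i * cs.minElt p ↔
      cs.simple i * cs.minElt p = cs.minElt p * cs.simple j := by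
    rw [mul_assoc, eq_inv_mul_iff_mul_eq, eq_comm]
  simp only [leftRed, rightRed, hleft, hright, Set.sep_eq_self_iff_mem_true]
  exact ⟨fun h => ⟨h.1, h.2⟩, fun h => ⟨h.1, h.2⟩⟩

theorem IsCoreMax.isCore (h : IsCoreMax cs I J y) : cs.IsCore I J (cs.coset I J y) := by
  refine ⟨⟨h.finitary_left, h.finitary_right, y, rfl⟩, leftRed_eq_and_rightRed_eq_iff.mpr ?_⟩
  rw [h.minElt_coset]
  exact (intertwines_longest h.finitary_left).mul h.intertwines

theorem exists_isCoreMax_of_isCore (h : cs.IsCore I J p) :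
    ∃ y, IsCoreMax cs I J y ∧ p = cs.coset I J y := by
  obtain ⟨⟨hI, -, w, rfl⟩, hred⟩ := h
  obtain ⟨m, hm, hmin⟩ := exists_isMinRep cs I J w
  rw [leftRed_eq_and_rightRed_eq_iff, hmin.minElt_eq hm] at hred
  refine ⟨cs.longest I * m, ⟨subset_leftDescents_longest_mul hI hmin.1,
    (intertwines_longest hI).mul hred⟩, ?_⟩
  exact (coset_eq_of_mem (mul_mem_coset (longest_mem hI) hm)).symm

theorem IsCoreMax.isIdentity_iff (h : IsCoreMax cs I J y) :
    cs.IsIdentity I J (cs.coset I J y) ↔ cs.leftDescents y = I := by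
  rw [IsIdentity, h.minElt_coset]
  have hIw := longest_mul_cancel_left h.finitary_left y
  constructor
  · rintro ⟨-, -, hm⟩
    rw [← hIw, hm, mul_one, leftDescents_longest h.finitary_left]
  · intro hD
    have hm : cs.longest I * y = 1 := by
      by_contra hne
      obtain ⟨i, hi⟩ := cs.exists_leftDescent_of_ne_one hne
      have hred := h.isMinRep.isReducedMul_right (longest_mem h.finitary_right)
      have hy : i ∈ cs.leftDescents y := by
        have hdesc := isLeftDescent_mul_of_isReducedMul hred hi
        rwa [h.longest_mul, mul_assoc, longest_mul_self h.finitary_right, mul_one] at hdesc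
      exact h.isMinRep.1 i (hD ▸ hy) hi
    refine ⟨h.isCore.1, ?_, hm⟩
    have hI : y = cs.longest I := by rw [← hIw, hm, mul_one]
    have hJ : y = cs.longest J := by
      rw [h.longest_mul] at hm
      rw [eq_inv_of_mul_eq_one_left hm, longest_inv h.finitary_right]
    rw [← leftDescents_longest h.finitary_left, ← hI, hJ, leftDescents_longest h.finitary_right]

theorem isCoreMax_longest (hI : cs.IsFinitary I) : IsCoreMax cs I I (cs.longest I) :=
  ⟨(leftDescents_longest hI).ge, intertwines_longest hI⟩

theorem IsOpposite.isCoreMax (hK : cs.IsFinitary K) (h : IsOpposite cs K s t) :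
    IsCoreMax cs (K \ {s}) (K \ {t}) (cs.longest K) :=
  ⟨Set.sdiff_subset.trans (leftDescents_longest hK).ge, h.intertwines_longest hK⟩

theorem IsCoreMax.longest_mul_longest_mul {I' : Set B} (h : IsCoreMax cs I J y)
    (hK : K ⊆ cs.leftDescents y) (hI' : I' ⊆ K) (hII' : Intertwines cs I I' (cs.longest K)) :
    IsCoreMax cs I' J (cs.longest I' * (cs.longest K * y)) := by
  have hKfin := isFinitary_of_subset_leftDescents hK
  have hI'fin := isFinitary_of_subset hKfin hI'
  refine ⟨subset_leftDescents_longest_mul hI'fin fun i hi =>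
    not_isLeftDescent_longest_mul hKfin hK (hI' hi), (intertwines_longest hI'fin).mul ?_⟩
  have hinv := hII'.inv
  rw [longest_inv hKfin] at hinv
  exact hinv.mul h.intertwines

theorem star_longest_longest_mul {I' : Set B} (hK : cs.IsFinitary K) (hI' : I' ⊆ K)
    (hm : ∀ i ∈ K, ¬ cs.IsLeftDescent m i) :
    cs.star (cs.longest K) (cs.longest I' * m) = cs.longest K * m :=
  star_longest_mul hK hm (parabolic_mono hI' (longest_mem (isFinitary_of_subset hK hI')))

theorem isReducedComp_of_maxElt_eq {I' : Set B} (hK : cs.IsFinitary K) (hI' : I' ⊆ K)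
    (hm : ∀ i ∈ K, ¬ cs.IsLeftDescent m i) (hp : cs.maxElt p = cs.longest K)
    (hq : cs.maxElt q = cs.longest I' * m) : cs.IsReducedComp I' p q := by
  have hI'fin := isFinitary_of_subset hK hI'
  have hmem := parabolic_mono hI' (longest_mem hI'fin)
  have hlen := length_add_length_longest_mul hK hmem
  have hKm := isReducedMul_of_not_isLeftDescent hm (longest_mem hK)
  have hI'm := isReducedMul_of_not_isLeftDescent hm hmem
  rw [IsReducedComp, hp, hq, star_longest_longest_mul hK hI' hm, longest_inv hI'fin,
    longest_mul_cancel_left hI'fin, mul_assoc, longest_mul_cancel_left hI'fin]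
  refine ⟨?_, rfl, hKm, rfl⟩
  rw [IsReducedMul] at hKm hI'm ⊢
  rw [mul_assoc, longest_mul_cancel_left hI'fin]
  lia

end CoreMax

section Expression

variable {K X Y Z : Set B} {L : List (Set B)} {s t : B}

theorem ssubset_or_ssubset_of_singleStep (h : SingleStep X Y) : X ⊂ Y ∨ Y ⊂ X := by
  obtain ⟨s, ⟨hs, rfl⟩ | ⟨hs, rfl⟩⟩ := h
  exacts [Or.inl (Set.ssubset_insert hs), Or.inr (Set.ssubset_insert hs)]

/-- `L = [X, …, Z]` is a sequence of finitary subsets in which consecutive subsets are strictly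
comparable, but may differ by several simple reflections. Expressions are of this form, and the
results on their lengths and descents do not need more; the inductive shape is the one of `exprElt`
and `exprLength`. -/
inductive IsMultistepExpr (cs : CoxeterSystem M W) (Z : Set B) : Set B → List (Set B) → Prop
  | single (hZ : cs.IsFinitary Z) : IsMultistepExpr cs Z Z [Z]
  | up {X Y : Set B} {L : List (Set B)} (hXY : X ⊂ Y) (hL : IsMultistepExpr cs Z Y (Y :: L)) :
      IsMultistepExpr cs Z X (X :: Y :: L)
  | down {X Y : Set B} {L : List (Set B)} (hYX : Y ⊂ X) (hX : cs.IsFinitary X)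
      (hL : IsMultistepExpr cs Z Y (Y :: L)) : IsMultistepExpr cs Z X (X :: Y :: L)

theorem isMultistepExpr_of_isExpression (h : cs.IsExpression X Z L) :
    IsMultistepExpr cs Z X L := by
  induction L generalizing X with
  | nil => simp [IsExpression] at h
  | cons A L ih =>
    obtain ⟨hhead, hlast, hfin, hchain⟩ := h
    obtain rfl : A = X := by simpa using hhead
    cases L with
    | nil =>
      obtain rfl : A = Z := by simpa using hlast
      exact .single (hfin A (by simp))
    | cons Y L =>
      rw [List.isChain_cons_cons] at hchain
      have htail : IsMultistepExpr cs Z Y (Y :: L) := ih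
        ⟨rfl, by simpa using hlast, fun K hK => hfin K (List.mem_cons_of_mem _ hK), hchain.2⟩
      rcases ssubset_or_ssubset_of_singleStep hchain.1 with hup | hdown
      exacts [.up hup htail, .down hdown (hfin A (by simp)) htail]

theorem exprElt_cons_of_subset (h : X ⊆ Y) (L : List (Set B)) :
    cs.exprElt (X :: Y :: L) = cs.exprElt (Y :: L) := by
  rw [exprElt, if_pos h, one_mul]

theorem exprElt_cons_of_ssubset (h : Y ⊂ X) (L : List (Set B)) :
    cs.exprElt (X :: Y :: L) = cs.longest X * (cs.longest Y)⁻¹ * cs.exprElt (Y :: L) := by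
  rw [exprElt, if_neg h.not_subset]

theorem exprLength_cons_of_subset (h : X ⊆ Y) (L : List (Set B)) :
    cs.exprLength (X :: Y :: L) = cs.exprLength (Y :: L) := by
  rw [exprLength, if_pos h, zero_add]

theorem exprLength_cons_of_ssubset (h : Y ⊂ X) (L : List (Set B)) :
    cs.exprLength (X :: Y :: L) =
      cs.length (cs.longest X) - cs.length (cs.longest Y) + cs.exprLength (Y :: L) := by
  rw [exprLength, if_neg h.not_subset]

theorem length_longest_mul_longest_inv (hX : cs.IsFinitary X) (h : Y ⊆ X) :
    cs.length (cs.longest Y) + cs.length (cs.longest X * (cs.longest Y)⁻¹) =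
      cs.length (cs.longest X) := by
  have hlen := length_add_length_longest_mul hX
    (inv_mem (parabolic_mono h (longest_mem (isFinitary_of_subset hX h))))
  rwa [length_inv] at hlen

namespace IsMultistepExpr

theorem finitary_head (h : IsMultistepExpr cs Z X L) : cs.IsFinitary X := by
  induction h with
  | single hZ => exact hZ
  | up hXY _ ih => exact isFinitary_of_subset ih hXY.subset
  | down _ hX => exact hX

theorem length_longest_head_le (h : IsMultistepExpr cs Z X L) :
    (cs.length (cs.longest X) : ℤ) ≤ cs.exprLength L := by
  induction h with
  | single => rw [exprLength]
  | up hXY hL ih =>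
    have := length_longest_lt hL.finitary_head hXY
    rw [exprLength_cons_of_subset hXY.subset]
    lia
  | down hYX _ _ ih =>
    rw [exprLength_cons_of_ssubset hYX]
    lia

theorem length_exprElt_le (h : IsMultistepExpr cs Z X L) :
    (cs.length (cs.exprElt L) : ℤ) ≤ cs.exprLength L := by
  induction h with
  | single => rw [exprLength, exprElt]
  | up hXY _ ih => rwa [exprElt_cons_of_subset hXY.subset, exprLength_cons_of_subset hXY.subset]
  | @down X Y L hYX hX _ ih =>
    rw [exprElt_cons_of_ssubset hYX, exprLength_cons_of_ssubset hYX]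
    have hlen := length_longest_mul_longest_inv hX hYX.subset
    have htri := cs.length_mul_le (cs.longest X * (cs.longest Y)⁻¹) (cs.exprElt (Y :: L))
    lia

theorem isReducedMul_of_down (hX : cs.IsFinitary X) (hYX : Y ⊂ X)
    (hL : IsMultistepExpr cs Z Y (Y :: L))
    (hred : (cs.length (cs.exprElt (X :: Y :: L)) : ℤ) = cs.exprLength (X :: Y :: L)) :
    cs.IsReducedMul (cs.longest X * (cs.longest Y)⁻¹) (cs.exprElt (Y :: L)) ∧
      (cs.length (cs.exprElt (Y :: L)) : ℤ) = cs.exprLength (Y :: L) := by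
  rw [exprElt_cons_of_ssubset hYX, exprLength_cons_of_ssubset hYX] at hred
  have hlen := length_longest_mul_longest_inv hX hYX.subset
  have htri := cs.length_mul_le (cs.longest X * (cs.longest Y)⁻¹) (cs.exprElt (Y :: L))
  have hle := hL.length_exprElt_le
  rw [IsReducedMul]
  lia

theorem subset_leftDescents_exprElt (h : IsMultistepExpr cs Z X L)
    (hred : (cs.length (cs.exprElt L) : ℤ) = cs.exprLength L) :
    X ⊆ cs.leftDescents (cs.exprElt L) := by
  induction h with
  | single hZ => exact (leftDescents_longest hZ).ge
  | up hXY _ ih =>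
    rw [exprElt_cons_of_subset hXY.subset, exprLength_cons_of_subset hXY.subset] at hred
    rw [exprElt_cons_of_subset hXY.subset]
    exact hXY.subset.trans (ih hred)
  | @down X Y L hYX hX hL ih =>
    obtain ⟨hmul, htail⟩ := isReducedMul_of_down hX hYX hL hred
    have hY := hL.finitary_head
    have hYmul := isReducedMul_longest_of_subset_leftDescents hY (ih htail)
    have hlen := length_longest_mul_longest_inv hX hYX.subset
    have hXmul : cs.IsReducedMul (cs.longest X) ((cs.longest Y)⁻¹ * cs.exprElt (Y :: L)) := by
      rw [IsReducedMul] at hmul hYmul ⊢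
      rw [longest_inv hY] at hmul hlen ⊢
      rw [longest_mul_cancel_left hY] at hYmul
      rw [← mul_assoc, hmul]
      lia
    rw [exprElt_cons_of_ssubset hYX, mul_assoc]
    exact fun i hi => isLeftDescent_mul_of_isReducedMul hXmul ((leftDescents_longest hX).ge hi)

theorem isRightDescent_exprElt (h : IsMultistepExpr cs Z X L)
    (hred : (cs.length (cs.exprElt L) : ℤ) = cs.exprLength L) :
    ∀ j ∈ Z, cs.IsRightDescent (cs.exprElt L) j := by
  induction h with
  | single hZ =>
    intro j hj
    rw [← isLeftDescent_inv_iff, exprElt, longest_inv hZ]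
    exact (leftDescents_longest hZ).ge hj
  | up hXY _ ih =>
    rw [exprElt_cons_of_subset hXY.subset, exprLength_cons_of_subset hXY.subset] at hred
    rw [exprElt_cons_of_subset hXY.subset]
    exact ih hred
  | down hYX hX hL ih =>
    obtain ⟨hmul, htail⟩ := isReducedMul_of_down hX hYX hL hred
    rw [exprElt_cons_of_ssubset hYX]
    exact fun j hj => isRightDescent_mul_of_isReducedMul hmul (ih htail j hj)

theorem exprLength_ne_of_up (hXY : X ⊂ Y) (hL : IsMultistepExpr cs Z Y (Y :: L)) :
    cs.exprLength (X :: Y :: L) ≠ cs.length (cs.longest X) := by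
  have hlt := length_longest_lt hL.finitary_head hXY
  have hle := hL.length_longest_head_le
  rw [exprLength_cons_of_subset hXY.subset]
  lia

theorem subset_of_exprLength_eq (h : IsMultistepExpr cs Z X L)
    (hlen : cs.exprLength L = cs.length (cs.longest X)) : Z ⊆ X := by
  induction h with
  | single => exact subset_rfl
  | up hXY hL => exact absurd hlen (exprLength_ne_of_up hXY hL)
  | down hYX _ _ ih =>
    rw [exprLength_cons_of_ssubset hYX] at hlen
    exact (ih (by lia)).trans hYX.subset

theorem eq_singleton (h : IsMultistepExpr cs Z Z L)
    (hlen : cs.exprLength L = cs.length (cs.longest Z)) : L = [Z] := by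
  cases h with
  | single => rfl
  | up hXY hL => exact absurd hlen (exprLength_ne_of_up hXY hL)
  | down hYX _ hL =>
    rw [exprLength_cons_of_ssubset hYX] at hlen
    exact absurd (hL.subset_of_exprLength_eq (by lia)) hYX.not_subset

theorem eq_pair (h : IsMultistepExpr cs Z X L) (hZX : Z ⋖ X)
    (hlen : cs.exprLength L = cs.length (cs.longest X)) : L = [X, Z] := by
  cases h with
  | single => exact absurd rfl hZX.ne
  | up hXY hL => exact absurd hlen (exprLength_ne_of_up hXY hL)
  | down hYX _ hL =>
    rw [exprLength_cons_of_ssubset hYX] at hlen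
    rcases hZX.eq_or_eq (hL.subset_of_exprLength_eq (by lia)) hYX.subset with rfl | rfl
    · rw [hL.eq_singleton (by lia)]
    · exact absurd rfl hYX.ne

theorem exprElt_ne_longest_of_down (hK : cs.IsFinitary K) (hopp : IsOpposite cs K s t)
    (hY : Y ⊂ K \ {s}) (hL : IsMultistepExpr cs (K \ {t}) Y (Y :: L))
    (hred : (cs.length (cs.exprElt (K \ {s} :: Y :: L)) : ℤ) =
      cs.exprLength (K \ {s} :: Y :: L)) :
    cs.exprElt (K \ {s} :: Y :: L) ≠ cs.longest K := by
  intro hw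
  have hIfin : cs.IsFinitary (K \ {s}) := isFinitary_of_subset hK Set.sdiff_subset
  obtain ⟨hmul, htail⟩ := isReducedMul_of_down hIfin hY hL hred
  rw [exprElt_cons_of_ssubset hY] at hw
  set u := cs.longest (K \ {s}) * (cs.longest Y)⁻¹
  set y := cs.exprElt (Y :: L)
  have hu_mem : u ∈ cs.parabolic (K \ {s}) := mul_mem (longest_mem hIfin)
    (inv_mem (parabolic_mono hY.subset (longest_mem hL.finitary_head)))
  have hlt : cs.length y < cs.length (cs.longest K) := by
    have hlen := length_longest_mul_longest_inv hIfin hY.subset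
    have hYlt := length_longest_lt hIfin hY
    rw [← hw, hmul]
    lia
  -- `y = u⁻¹ w_K = w_K û⁻¹` with `û ∈ W_{K \ {t}}`, and all of `K \ {t}` are right descents of `y`.
  have hge : cs.length (cs.longest K) ≤ cs.length y := by
    have hconj := ((hopp.intertwines_longest hK).conj_mem hu_mem).1
    have hyu : y * ((cs.longest K)⁻¹ * u * cs.longest K) = cs.longest K := by
      rw [← hw]
      group
    have hsplit := isReducedMul_mul_of_subset_rightDescents (hL.isRightDescent_exprElt htail) hconj
    rw [IsReducedMul, hyu, ← eq_mul_inv_of_mul_eq hyu] at hsplit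
    lia
  exact hlt.not_ge hge

theorem eq_atomic (hK : cs.IsFinitary K) (hs : s ∈ K) (hopp : IsOpposite cs K s t)
    (h : IsMultistepExpr cs (K \ {t}) (K \ {s}) L) (helt : cs.exprElt L = cs.longest K)
    (hlen : cs.exprLength L = cs.length (cs.longest K)) : L = [K \ {s}, K, K \ {t}] := by
  have hIK : K \ {s} ⋖ K := Set.sdiff_singleton_covBy hs
  have hI'K : K \ {t} ⋖ K := Set.sdiff_singleton_covBy (hopp.mem hK hs)
  have hred : (cs.length (cs.exprElt L) : ℤ) = cs.exprLength L := by rw [helt, hlen]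
  generalize hI : K \ {s} = I at h hIK
  cases h with
  | single hZ =>
    have := length_longest_lt hK hI'K.lt
    rw [exprLength] at hlen
    lia
  | up hXY hL =>
    rw [exprElt_cons_of_subset hXY.subset] at helt hred
    rw [exprLength_cons_of_subset hXY.subset] at hlen hred
    have hsub := hL.subset_leftDescents_exprElt hred
    rw [helt, leftDescents_longest hK] at hsub
    obtain rfl := (hIK.eq_or_eq hXY.subset hsub).resolve_left hXY.ne'
    rw [hL.eq_pair hI'K hlen]
  | down hYX _ hL =>
    subst hI
    exact absurd helt (exprElt_ne_longest_of_down hK hopp hYX hL hred)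

end IsMultistepExpr

end Expression

section Algorithm

variable {I I' J K : Set B} {L : List (Set B)} {q : Set W} {s t : B} {y : W}

/-- The maximal element of the coset to which one step of the algorithm passes from the coset with
maximal element `y`; here `K = Is`. -/
noncomputable def remainder (cs : CoxeterSystem M W) (K : Set B) (t : B) (y : W) : W :=
  cs.longest (K \ {t}) * (cs.longest K * y)

theorem longest_mul_longest_mul_remainder (hK : cs.IsFinitary K) :
    cs.longest K * (cs.longest (K \ {t}))⁻¹ * remainder cs K t y = y := by
  rw [remainder, mul_assoc, inv_mul_cancel_left, longest_mul_cancel_left hK]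

theorem remainder_longest (hK : cs.IsFinitary K) :
    remainder cs K t (cs.longest K) = cs.longest (K \ {t}) := by
  rw [remainder, longest_mul_self hK, mul_one]

theorem length_remainder (hK : K ⊆ cs.leftDescents y) :
    (cs.length y : ℤ) = cs.length (cs.longest K) - cs.length (cs.longest (K \ {t})) +
      cs.length (remainder cs K t y) := by
  have hKfin := isFinitary_of_subset_leftDescents hK
  have hI'fin := isFinitary_of_subset hKfin (Set.sdiff_subset (t := {t}))
  have hred := isReducedMul_longest_of_subset_leftDescents hKfin hK
  have hrem : cs.length (remainder cs K t y) = _ := isReducedMul_of_not_isLeftDescent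
    (fun i hi => not_isLeftDescent_longest_mul hKfin hK (Set.sdiff_subset hi)) (longest_mem hI'fin)
  rw [IsReducedMul, longest_mul_cancel_left hKfin] at hred
  lia

theorem length_remainder_lt (hK : K ⊆ cs.leftDescents y) (ht : t ∈ K) :
    cs.length (remainder cs K t y) < cs.length y := by
  have hlt := length_longest_lt (isFinitary_of_subset_leftDescents hK)
    (Set.sdiff_singleton_ssubset.mpr ht)
  have hlen := length_remainder (t := t) hK
  lia

theorem IsCoreMax.insert_subset_leftDescents (hy : IsCoreMax cs I J y)
    (hs : s ∈ cs.leftDescents y \ I) : insert s I ⊆ cs.leftDescents y :=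
  Set.insert_subset hs.1 hy.subset_leftDescents

theorem IsCoreMax.isFinitary_insert (hy : IsCoreMax cs I J y) (hs : s ∈ cs.leftDescents y \ I) :
    cs.IsFinitary (insert s I) :=
  isFinitary_of_subset_leftDescents (hy.insert_subset_leftDescents hs)

theorem isCoreMax_longest_insert (hs : s ∉ I) (hK : cs.IsFinitary (insert s I))
    (ht : IsOpposite cs (insert s I) s t) :
    IsCoreMax cs I (insert s I \ {t}) (cs.longest (insert s I)) := by
  simpa only [Set.insert_sdiff_self_of_notMem hs] using ht.isCoreMax hK

theorem IsCoreMax.isCoreMax_remainder (hy : IsCoreMax cs I J y) (hs : s ∈ cs.leftDescents y \ I)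
    (ht : IsOpposite cs (insert s I) s t) :
    IsCoreMax cs (insert s I \ {t}) J (remainder cs (insert s I) t y) :=
  hy.longest_mul_longest_mul (hy.insert_subset_leftDescents hs) Set.sdiff_subset
    (isCoreMax_longest_insert hs.2 (hy.isFinitary_insert hs) ht).intertwines

theorem IsCoreMax.length_maxElt_remainder_lt (hy : IsCoreMax cs I J y)
    (hs : s ∈ cs.leftDescents y \ I) (ht : IsOpposite cs (insert s I) s t) :
    cs.length (cs.maxElt (cs.coset (insert s I \ {t}) J (remainder cs (insert s I) t y))) <
      cs.length y := by
  rw [(hy.isCoreMax_remainder hs ht).maxElt_coset]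
  exact length_remainder_lt (hy.insert_subset_leftDescents hs)
    (ht.mem (hy.isFinitary_insert hs) (Set.mem_insert s I))

theorem IsCoreMax.isReducedComp_remainder (hy : IsCoreMax cs I J y)
    (hs : s ∈ cs.leftDescents y \ I) (ht : IsOpposite cs (insert s I) s t) :
    cs.IsReducedComp (insert s I \ {t})
      (cs.coset I (insert s I \ {t}) (cs.longest (insert s I)))
      (cs.coset (insert s I \ {t}) J (remainder cs (insert s I) t y)) :=
  have hK := hy.isFinitary_insert hs
  isReducedComp_of_maxElt_eq hK Set.sdiff_subset
    (fun _ hi => not_isLeftDescent_longest_mul hK (hy.insert_subset_leftDescents hs) hi)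
    (isCoreMax_longest_insert hs.2 hK ht).maxElt_coset (hy.isCoreMax_remainder hs ht).maxElt_coset

theorem IsCoreMax.comp_remainder (hy : IsCoreMax cs I J y)
    (hs : s ∈ cs.leftDescents y \ I) (ht : IsOpposite cs (insert s I) s t) :
    cs.comp I J (cs.coset I (insert s I \ {t}) (cs.longest (insert s I)))
      (cs.coset (insert s I \ {t}) J (remainder cs (insert s I) t y)) =
      cs.coset I J y := by
  have hK := hy.isFinitary_insert hs
  rw [comp, (isCoreMax_longest_insert hs.2 hK ht).maxElt_coset,
    (hy.isCoreMax_remainder hs ht).maxElt_coset, remainder,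
    star_longest_longest_mul hK Set.sdiff_subset fun _ hi =>
      not_isLeftDescent_longest_mul hK (hy.insert_subset_leftDescents hs) hi,
    longest_mul_cancel_left hK]

theorem isExpression_cons_insert (hs : s ∉ I) (hK : cs.IsFinitary (insert s I))
    (ht : t ∈ insert s I) (h : cs.IsExpression (insert s I \ {t}) J ((insert s I \ {t}) :: L)) :
    cs.IsExpression I J (I :: insert s I :: (insert s I \ {t}) :: L) := by
  obtain ⟨-, hlast, hfin, hchain⟩ := h
  have hup : SingleStep I (insert s I) := ⟨s, Or.inl ⟨hs, rfl⟩⟩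
  have hdown : SingleStep (insert s I) (insert s I \ {t}) :=
    ⟨t, Or.inr ⟨fun h => h.2 rfl, by rw [Set.insert_sdiff_singleton, Set.insert_eq_of_mem ht]⟩⟩
  refine ⟨rfl, by simpa only [List.getLast?_cons_cons] using hlast, ?_,
    List.isChain_cons_cons.mpr ⟨hup, List.isChain_cons_cons.mpr ⟨hdown, hchain⟩⟩⟩
  exact List.forall_mem_cons.mpr ⟨isFinitary_of_subset hK (Set.subset_insert s I),
    List.forall_mem_cons.mpr ⟨hK, hfin⟩⟩

theorem isReducedExpr_longest_iff (hI : cs.IsFinitary I) :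
    cs.IsReducedExpr I I L (cs.coset I I (cs.longest I)) ↔ L = [I] := by
  have hy := isCoreMax_longest hI
  rw [IsReducedExpr, hy.maxElt_coset]
  constructor
  · rintro ⟨-, hexpr, -, hlen⟩
    exact (isMultistepExpr_of_isExpression hexpr).eq_singleton hlen.symm
  · rintro rfl
    exact ⟨hy.isCore.1, ⟨rfl, rfl, by simpa using hI, List.isChain_singleton _⟩,
      by rw [exprElt], by rw [exprLength]⟩

theorem IsCoreMax.isReducedExpr_cons_insert (hy : IsCoreMax cs I J y)
    (hs : s ∈ cs.leftDescents y \ I) (ht : IsOpposite cs (insert s I) s t)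
    (h : cs.IsReducedExpr (insert s I \ {t}) J ((insert s I \ {t}) :: L)
      (cs.coset (insert s I \ {t}) J (remainder cs (insert s I) t y))) :
    cs.IsReducedExpr I J (I :: insert s I :: (insert s I \ {t}) :: L) (cs.coset I J y) := by
  have hK := hy.isFinitary_insert hs
  have htK := ht.mem hK (Set.mem_insert s I)
  have hlt : insert s I \ {t} ⊂ insert s I := Set.sdiff_singleton_ssubset.mpr htK
  obtain ⟨-, hexpr, helt, hlen⟩ := h
  rw [(hy.isCoreMax_remainder hs ht).maxElt_coset] at helt hlen
  refine ⟨hy.isCore.1, isExpression_cons_insert hs.2 hK htK hexpr, ?_, ?_⟩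
  · rw [hy.maxElt_coset, exprElt_cons_of_subset (Set.subset_insert s I),
      exprElt_cons_of_ssubset hlt, ← helt, longest_mul_longest_mul_remainder hK]
  · rw [hy.maxElt_coset, exprLength_cons_of_subset (Set.subset_insert s I),
      exprLength_cons_of_ssubset hlt, ← hlen,
      length_remainder (t := t) (hy.insert_subset_leftDescents hs)]

theorem isReducedExpr_longest_insert_iff (hs : s ∉ I) (hK : cs.IsFinitary (insert s I))
    (ht : IsOpposite cs (insert s I) s t) :
    cs.IsReducedExpr I (insert s I \ {t}) L
      (cs.coset I (insert s I \ {t}) (cs.longest (insert s I))) ↔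
      L = [I, insert s I, insert s I \ {t}] := by
  have hy := isCoreMax_longest_insert hs hK ht
  constructor
  · rintro ⟨-, hexpr, helt, hlen⟩
    rw [hy.maxElt_coset] at helt hlen
    have hI : insert s I \ {s} = I := Set.insert_sdiff_self_of_notMem hs
    have hexpr' : IsMultistepExpr cs (insert s I \ {t}) (insert s I \ {s}) L := by
      simpa only [hI] using isMultistepExpr_of_isExpression hexpr
    simpa only [hI] using hexpr'.eq_atomic hK (Set.mem_insert s I) ht helt.symm hlen.symm
  · rintro rfl
    refine hy.isReducedExpr_cons_insert
      ⟨(leftDescents_longest hK).ge (Set.mem_insert s I), hs⟩ ht ?_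
    rw [remainder_longest hK]
    exact (isReducedExpr_longest_iff (isFinitary_of_subset hK Set.sdiff_subset)).mpr rfl

theorem isAtomic_longest_insert (hs : s ∉ I) (hK : cs.IsFinitary (insert s I))
    (ht : IsOpposite cs (insert s I) s t) :
    cs.IsAtomic I (insert s I \ {t})
      (cs.coset I (insert s I \ {t}) (cs.longest (insert s I))) :=
  ⟨(isCoreMax_longest_insert hs hK ht).isCore, s, t,
    (isReducedExpr_longest_insert_iff hs hK ht).mpr rfl⟩

theorem IsCoreMax.eq_of_leftDescents_eq (hy : IsCoreMax cs I J y)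
    (hD : cs.leftDescents y = I) : I = J ∧ y = cs.longest I := by
  obtain ⟨-, hIJ, hm⟩ := hy.isIdentity_iff.mpr hD
  rw [hy.minElt_coset] at hm
  exact ⟨hIJ, by rw [← longest_mul_cancel_left hy.finitary_left y, hm, mul_one]⟩

theorem IsCoreMax.leftDescents_sdiff_nonempty (hy : IsCoreMax cs I J y)
    (hD : cs.leftDescents y ≠ I) : (cs.leftDescents y \ I).Nonempty :=
  Set.nonempty_of_ssubset (hy.subset_leftDescents.ssubset_of_ne hD.symm)

theorem IsCoreMax.algStep_iff (hy : IsCoreMax cs I J y) :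
    cs.AlgStep J I (cs.coset I J y) s t I' q ↔
      s ∈ cs.leftDescents y \ I ∧ IsOpposite cs (insert s I) s t ∧ I' = insert s I \ {t} ∧
        q = cs.coset I' J (remainder cs (insert s I) t y) := by
  rw [AlgStep, hy.maxElt_coset, IsOpposite]
  refine and_congr_right' (and_congr_right' (and_congr_right ?_))
  rintro rfl
  rw [remainder, mul_assoc]

theorem IsCoreMax.exists_algStep (hy : IsCoreMax cs I J y) (hs : s ∈ cs.leftDescents y \ I) :
    ∃ t I' q, cs.AlgStep J I (cs.coset I J y) s t I' q := by
  obtain ⟨t, -, ht⟩ := exists_isOpposite (hy.isFinitary_insert hs) (Set.mem_insert s I)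
  exact ⟨t, _, _, hy.algStep_iff.mpr ⟨hs, ht, rfl, rfl⟩⟩

theorem IsCoreMax.exists_algRun (hy : IsCoreMax cs I J y) :
    ∃ l, cs.AlgRun J I (cs.coset I J y) l := by
  induction hn : cs.length y using Nat.strong_induction_on generalizing I y with
  | _ n ih =>
    by_cases hD : cs.leftDescents y = I
    · exact ⟨[], .halt (by rwa [hy.maxElt_coset])⟩
    obtain ⟨s, hs⟩ := hy.leftDescents_sdiff_nonempty hD
    obtain ⟨t, htK, ht⟩ := exists_isOpposite (hy.isFinitary_insert hs) (Set.mem_insert s I)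
    obtain ⟨l, hl⟩ := ih _ (hn ▸ length_remainder_lt (hy.insert_subset_leftDescents hs) htK)
      (hy.isCoreMax_remainder hs ht) rfl
    exact ⟨(s, t) :: l, .step (hy.algStep_iff.mpr ⟨hs, ht, rfl, rfl⟩) hl⟩

theorem exists_plusMinus_eq_cons (I : Set B) (l : List (B × B)) : ∃ L, plusMinus I l = I :: L := by
  cases l with
  | nil => exact ⟨[], rfl⟩
  | cons st l => exact ⟨_, rfl⟩

theorem isReducedAtomicExpr_nil (hJ : cs.IsFinitary J) :
    cs.IsReducedAtomicExpr J J [] (cs.coset J J (cs.longest J)) := by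
  refine ⟨(isReducedExpr_longest_iff hJ).mpr rfl, ?_⟩
  have hone := mul_mem_coset (longest_mem hJ) (self_mem_coset cs J J 1)
  rw [mul_one] at hone
  exact coset_eq_of_mem hone ▸ .nil

theorem IsCoreMax.isReducedAtomicExpr_cons {l : List (B × B)} (hy : IsCoreMax cs I J y)
    (hs : s ∈ cs.leftDescents y \ I) (ht : IsOpposite cs (insert s I) s t)
    (h : cs.IsReducedAtomicExpr (insert s I \ {t}) J l
      (cs.coset (insert s I \ {t}) J (remainder cs (insert s I) t y))) :
    cs.IsReducedAtomicExpr I J ((s, t) :: l) (cs.coset I J y) := by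
  have hK := hy.isFinitary_insert hs
  obtain ⟨hexpr, hcomp⟩ := h
  constructor
  · obtain ⟨L, hL⟩ := exists_plusMinus_eq_cons (insert s I \ {t}) l
    rw [hL] at hexpr
    rw [plusMinus, hL]
    exact hy.isReducedExpr_cons_insert hs ht hexpr
  · rw [← hy.comp_remainder hs ht]
    exact .cons ht (isAtomic_longest_insert hs.2 hK ht)
      ((isReducedExpr_longest_insert_iff hs.2 hK ht).mpr rfl) (hy.isReducedComp_remainder hs ht)
      hcomp

theorem IsCoreMax.isReducedAtomicExpr_of_algRun {l : List (B × B)} (hy : IsCoreMax cs I J y)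
    (h : cs.AlgRun J I (cs.coset I J y) l) : cs.IsReducedAtomicExpr I J l (cs.coset I J y) := by
  generalize hp : cs.coset I J y = p at h
  induction h generalizing y with
  | halt hD =>
    rw [← hp, hy.maxElt_coset] at hD
    obtain ⟨rfl, rfl⟩ := hy.eq_of_leftDescents_eq hD
    exact hp ▸ isReducedAtomicExpr_nil hy.finitary_left
  | step hstep _ ih =>
    rw [← hp, hy.algStep_iff] at hstep
    obtain ⟨hs, ht, rfl, rfl⟩ := hstep
    exact hp ▸ hy.isReducedAtomicExpr_cons hs ht (ih (hy.isCoreMax_remainder hs ht) rfl)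

end Algorithm

end CoreCoset

theorem mainTheorem1 {B W : Type*} [Group W] {M : CoxeterMatrix B} (cs : CoxeterSystem M W)
    (I J : Set B) (r : Set W) (hr : cs.IsCore I J r) :
    -- a reduced atomic expression exists
    (∃ l : List (B × B), cs.IsReducedAtomicExpr I J l r) ∧
    -- an identity coset, or a reduced composition of an atomic coset and a core coset
    ((cs.IsIdentity I J r ∧ ∀ L, cs.IsReducedExpr I J L r ↔ L = [I]) ∨
      (∃ (s t : B) (I' : Set B) (p q : Set W),
        s ∉ I ∧ cs.IsFinitary (insert s I) ∧
        cs.simple t = cs.longest (insert s I) * cs.simple s * cs.longest (insert s I) ∧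
        I' = insert s I \ {t} ∧
        cs.IsAtomic I I' p ∧ cs.IsCore I' J q ∧
        cs.IsReducedComp I' p q ∧ r = cs.comp I J p q ∧
        ∀ L, cs.IsReducedExpr I I' L p ↔ L = [I, insert s I, I'])) ∧
    -- the algorithm: it halts exactly at identity cosets, and otherwise every choice of `s` works
    (cs.leftDescents (cs.maxElt r) = I ↔ cs.IsIdentity I J r) ∧
    (cs.leftDescents (cs.maxElt r) ≠ I → (cs.leftDescents (cs.maxElt r) \ I).Nonempty) ∧
    (∀ s ∈ cs.leftDescents (cs.maxElt r) \ I, ∃ t I' q, cs.AlgStep J I r s t I' q) ∧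
    (∀ s t I' q, cs.AlgStep J I r s t I' q →
      cs.IsFinitary (insert s I) ∧
      cs.IsAtomic I I' (cs.coset I I' (cs.longest (insert s I))) ∧
      cs.IsReducedExpr I I' [I, insert s I, I'] (cs.coset I I' (cs.longest (insert s I))) ∧
      cs.IsCore I' J q ∧
      cs.IsReducedComp I' (cs.coset I I' (cs.longest (insert s I))) q ∧
      r = cs.comp I J (cs.coset I I' (cs.longest (insert s I))) q ∧
      cs.length (cs.maxElt q) < cs.length (cs.maxElt r)) ∧
    (∃ l, cs.AlgRun J I r l) ∧
    (∀ l, cs.AlgRun J I r l → cs.IsReducedAtomicExpr I J l r) := by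
  obtain ⟨y, hy, rfl⟩ := CoreCoset.exists_isCoreMax_of_isCore hr
  obtain ⟨l, hl⟩ := hy.exists_algRun
  simp only [hy.maxElt_coset]
  refine ⟨⟨l, hy.isReducedAtomicExpr_of_algRun hl⟩, ?_, hy.isIdentity_iff.symm,
    hy.leftDescents_sdiff_nonempty, fun _ => hy.exists_algStep, ?_, ⟨l, hl⟩,
    fun _ => hy.isReducedAtomicExpr_of_algRun⟩
  · by_cases hD : cs.leftDescents y = I
    · refine Or.inl ⟨hy.isIdentity_iff.mpr hD, fun L => ?_⟩
      obtain ⟨rfl, rfl⟩ := hy.eq_of_leftDescents_eq hD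
      exact CoreCoset.isReducedExpr_longest_iff hy.finitary_left
    · obtain ⟨s, hs⟩ := hy.leftDescents_sdiff_nonempty hD
      have hK := hy.isFinitary_insert hs
      obtain ⟨t, -, ht⟩ := CoreCoset.exists_isOpposite hK (Set.mem_insert s I)
      exact Or.inr ⟨s, t, _, _, _, hs.2, hK, ht, rfl,
        CoreCoset.isAtomic_longest_insert hs.2 hK ht, (hy.isCoreMax_remainder hs ht).isCore,
        hy.isReducedComp_remainder hs ht, (hy.comp_remainder hs ht).symm,
        fun _ => CoreCoset.isReducedExpr_longest_insert_iff hs.2 hK ht⟩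
  · intro s t I' q hstep
    obtain ⟨hs, ht, rfl, rfl⟩ := hy.algStep_iff.mp hstep
    have hK := hy.isFinitary_insert hs
    exact ⟨hK, CoreCoset.isAtomic_longest_insert hs.2 hK ht,
      (CoreCoset.isReducedExpr_longest_insert_iff hs.2 hK ht).mpr rfl,
      (hy.isCoreMax_remainder hs ht).isCore, hy.isReducedComp_remainder hs ht,
      (hy.comp_remainder hs ht).symm, hy.length_maxElt_remainder_lt hs ht⟩
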